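/- **Theorem 2.3 (Uniqueness Theorem).** Let $L^2(0,1)$ be the space of real square-integrable functions on $(0,1)$. For $(q;b)\in L^2(0,1)\times\mathbb R$ let $H$ be the self-adjoint operator $H\psi=-\psi''+q\psi$ in $L^2(0,1)$ with the boundary conditions $\psi(0)=0$, $\psi'(1)+b\psi(1)=0$, and let $\lambda_0(q,b)<\lambda_1(q,b)<\dots$ be its eigenvalues, all of which are simple. For $\lambda\in\mathbb R$ let $\varphi(\cdot,\lambda,q)$ be the solution of $-\varphi''+q\varphi=\lambda\varphi$ on $[0,1]$ with $\varphi(0)=0$, $\varphi'(0)=1$, and define the norming constants by $$\nu_n(q,b)=\log\left[(-1)^n\varphi(1,\lambda_n(q,b),q)\right],\qquad n\ge 0 .$$ If $(q;b),(p;h)\in L^2(0,1)\times\mathbb R$ satisfy $\lambda_n(q,b)=\lambda_n(p,h)$ and $\nu_n(q,b)=\nu_n(p,h)$ for all $n\ge 0$, then $(q;b)=(p;h)$, that is, $q=p$ almost everywhere on $(0,1)$ and $b=h$. -/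

import Mathlib

open MeasureTheory Set

noncomputable section

namespace MixedSturmLiouville

/-- Lebesgue measure on `(0,1)`. -/
abbrev unitMeasure : Measure ℝ := volume.restrict (Ioo (0 : ℝ) 1)

/-- The real Hilbert space `L²(0,1)`. -/
abbrev L2 : Type := Lp ℝ 2 unitMeasure

/-- The derivative `y'` of a function on `[0,1]`, one-sided at the endpoints. -/
def D (y : ℝ → ℝ) : ℝ → ℝ := derivWithin y (Icc 0 1)

/-- `y` is differentiable on `[0,1]` and `y'` is absolutely continuous there, so that `y''` exists
almost everywhere, is integrable, and `y'` is a primitive of it. -/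
structure IsRegular (y : ℝ → ℝ) : Prop where
  differentiableOn : DifferentiableOn ℝ y (Icc 0 1)
  absolutelyContinuous : AbsolutelyContinuousOnInterval (D y) 0 1

/-- The differential expression `-y'' + q y`. -/
def expression (q y : ℝ → ℝ) : ℝ → ℝ := fun x => -deriv (D y) x + q x * y x

/-- The domain of the operator `H = -d²/dx² + q` in `L²(0,1)` with the boundary conditions
`y(0) = 0`, `y'(1) + b y(1) = 0`. -/
structure InDomain (q : ℝ → ℝ) (b : ℝ) (y : ℝ → ℝ) : Prop where
  regular : IsRegular y
  memLp : MemLp (expression q y) 2 unitMeasure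
  left_bc : y 0 = 0
  right_bc : D y 1 + b * y 1 = 0

/-- `r` is an eigenvalue of the self-adjoint operator `H`: some `y ≠ 0` in the domain of `H`
satisfies `H y = r y` in `L²(0,1)`. -/
def IsEigenvalue (q : ℝ → ℝ) (b r : ℝ) : Prop :=
  ∃ y : ℝ → ℝ, InDomain q b y ∧ ¬ y =ᵐ[unitMeasure] 0 ∧
    expression q y =ᵐ[unitMeasure] fun x => r * y x

/-- `λₙ(q,b)`, `n ≥ 0`: the eigenvalues of `H` in increasing order (all of them are simple).
The value at `n` is the least `t` such that at least `n + 1` eigenvalues are `≤ t`. -/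
def eigenvalue (q : ℝ → ℝ) (b : ℝ) (n : ℕ) : ℝ :=
  sInf {t : ℝ | (n + 1 : ℕ∞) ≤ {r : ℝ | IsEigenvalue q b r ∧ r ≤ t}.encard}

/-- `y` solves `-y'' + q y = r y` on `[0,1]` with `y(0) = 0`, `y'(0) = 1`. -/
structure IsPhi (q : ℝ → ℝ) (r : ℝ) (y : ℝ → ℝ) : Prop where
  regular : IsRegular y
  equation : expression q y =ᵐ[unitMeasure] fun x => r * y x
  value_zero : y 0 = 0
  deriv_zero : D y 0 = 1

/-- `φ(·,r,q)`: the solution of the initial value problem `IsPhi`. It is unique on `[0,1]`; outside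
this interval the values have no meaning. -/
def phi (q : ℝ → ℝ) (r : ℝ) : ℝ → ℝ := Classical.epsilon (IsPhi q r)

/-- The norming constants `νₙ(q,b) = log[(-1)ⁿ φ(1, λₙ(q,b), q)]`. -/
def normingConstant (q : ℝ → ℝ) (b : ℝ) (n : ℕ) : ℝ :=
  Real.log ((-1) ^ n * phi q (eigenvalue q b n) 1)

end MixedSturmLiouville

end

/-! Let `φ` solve the equation with `φ(0) = 0`, `φ'(0) = 1`, let `ψ` solve it with `ψ(1) = 1`,
`ψ'(1) = -b`, and let `w(l) = φ'(1,l) + b φ(1,l)`, which is the Wronskian `φ'ψ - φψ'`. All three are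
entire in `l`. The zeros of `w` are the eigenvalues; they are real and simple, and at each of them
`φ = φ(1) ψ`, so the norming constant measures the ratio of the two solutions.

Write `φ~`, `ψ~`, `w~` for the second pair. For fixed `x`, the entire function `G = φ ψ~ - φ~ ψ`
vanishes at the common eigenvalues, because there `φ(1) = φ~(1)`. Hence `G / w` is entire. With `l =
z²`, `G` is `O(e^{|Im z|}/|z|)`, while `w` is close to `cos z` and so at least `e^{|Im z|}/8` on
large squares of half-side `kπ`. The maximum principle gives `G = 0`
(`eq_zero_of_vanishing_at_zeros`, `solution_mul_psi_eq`). No product formula and no eigenvalue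
asymptotics are needed.

Now `φ/ψ = φ~/ψ~`. Differentiating in `x` gives `w/ψ² = w~/ψ~²` (`charFun_mul_psi_sq_eq`); `x = 1`
yields `w = w~`, so `ψ² = ψ~²`. For one very negative `l` both `ψ` and `ψ~` are positive, hence
equal, and the differential equation and the condition at `1` return `q = p` and `b = h`.

`Real.log` determines only `|φ(1)|`. The sign comes from `φ(1) w' = -∫ φ² < 0` at an eigenvalue: `w`
and `w~` have the same simple zeros and are both positive near `-∞`, so their derivatives agree in
sign there (`solution_one_mul_pos`). Of the ordering of the eigenvalues only the set of values is
used (`range_eigenvalue`). -/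

open Filter Topology

namespace MixedSturmLiouville

/-! ### Primitives of integrable functions on `[0,1]` -/

section Primitive

variable {𝕜 : Type*} [RCLike 𝕜]

/-- On `[0,1]`, `u` is a primitive of the integrable function `f`. -/
structure IsPrimitive (u f : ℝ → 𝕜) : Prop where
  intervalIntegrable : IntervalIntegrable f volume 0 1
  eq_add_integral : ∀ x ∈ Icc (0 : ℝ) 1, u x = u 0 + ∫ t in (0 : ℝ)..x, f t

theorem intervalIntegrable_of_mem {f : ℝ → 𝕜} (hf : IntervalIntegrable f volume 0 1) {x y : ℝ}
    (hx : x ∈ Icc (0 : ℝ) 1) (hy : y ∈ Icc (0 : ℝ) 1) : IntervalIntegrable f volume x y :=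
  hf.mono_set (by
    rw [uIcc_of_le zero_le_one]
    exact uIcc_subset_Icc hx hy)

theorem absolutelyContinuousOnInterval_congr {u v : ℝ → 𝕜} (h : EqOn u v (Icc 0 1))
    (hu : AbsolutelyContinuousOnInterval u 0 1) : AbsolutelyContinuousOnInterval v 0 1 := by
  rw [absolutelyContinuousOnInterval_iff] at hu ⊢
  intro ε hε
  obtain ⟨δ, hδ, H⟩ := hu ε hε
  refine ⟨δ, hδ, fun E hE hE' => ?_⟩
  have := H E hE hE'
  rwa [Finset.sum_congr rfl fun i hi => ?_] at this
  have := hE.1 i hi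
  rw [uIcc_of_le zero_le_one] at this
  rw [h this.1, h this.2]

/-- Increments of this primitive are dominated by those of the primitive of the real function `‖f‖`.
-/
theorem absolutelyContinuousOnInterval_integral {f : ℝ → 𝕜} (hf : IntervalIntegrable f volume 0 1) :
    AbsolutelyContinuousOnInterval (fun x => ∫ t in (0 : ℝ)..x, f t) 0 1 := by
  have h1 := hf.norm.absolutelyContinuousOnInterval_intervalIntegral (c := 0) (by simp)
  rw [absolutelyContinuousOnInterval_iff] at h1 ⊢
  intro ε hε
  obtain ⟨δ, hδ, H⟩ := h1 ε hε
  refine ⟨δ, hδ, fun E hE hE' => lt_of_le_of_lt (Finset.sum_le_sum fun i hi => ?_) (H E hE hE')⟩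
  have hm := hE.1 i hi
  rw [uIcc_of_le zero_le_one] at hm
  have h0 : (0 : ℝ) ∈ Icc (0 : ℝ) 1 := by simp
  rw [dist_eq_norm, dist_eq_norm,
    intervalIntegral.integral_interval_sub_left (intervalIntegrable_of_mem hf h0 hm.1)
      (intervalIntegrable_of_mem hf h0 hm.2),
    intervalIntegral.integral_interval_sub_left (intervalIntegrable_of_mem hf.norm h0 hm.1)
      (intervalIntegrable_of_mem hf.norm h0 hm.2)]
  exact intervalIntegral.norm_integral_le_abs_integral_norm

theorem IsPrimitive.absolutelyContinuous {u f : ℝ → 𝕜} (h : IsPrimitive u f) :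
    AbsolutelyContinuousOnInterval u 0 1 := by
  have h1 := absolutelyContinuousOnInterval_integral h.intervalIntegrable
  have h2 : AbsolutelyContinuousOnInterval (fun _ : ℝ => u 0) 0 1 := by
    rw [absolutelyContinuousOnInterval_iff]
    intro ε hε
    exact ⟨1, one_pos, fun E _ _ => by simpa using hε⟩
  exact absolutelyContinuousOnInterval_congr (fun x hx => (h.eq_add_integral x hx).symm)
    (h2.add h1)

theorem IsPrimitive.continuousOn {u f : ℝ → 𝕜} (h : IsPrimitive u f) :
    ContinuousOn u (Icc 0 1) := by
  simpa using h.absolutelyContinuous.continuousOn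

theorem IsPrimitive.ae_hasDerivAt {u f : ℝ → 𝕜} (h : IsPrimitive u f) :
    ∀ᵐ x, x ∈ Ioo (0 : ℝ) 1 → HasDerivAt u (f x) x := by
  filter_upwards [h.intervalIntegrable.ae_hasDerivAt_integral] with x hx hx'
  have hx1 : x ∈ uIcc (0 : ℝ) 1 := by
    rw [uIcc_of_le zero_le_one]; exact Ioo_subset_Icc_self hx'
  have := (hx hx1 0 (by simp)).const_add (u 0)
  refine this.congr_of_eventuallyEq ?_
  filter_upwards [Icc_mem_nhds hx'.1 hx'.2] with y hy
  exact h.eq_add_integral y hy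

theorem ae_mem_Ioo_of_mem_uIcc : ∀ᵐ x : ℝ, x ∈ uIcc (0 : ℝ) 1 → x ∈ Ioo (0 : ℝ) 1 := by
  have h0 : ∀ᵐ x : ℝ, x ≠ 0 := by simp [ae_iff]
  have h1 : ∀ᵐ x : ℝ, x ≠ 1 := by simp [ae_iff]
  filter_upwards [h0, h1] with x hx0 hx1 hx
  rw [uIcc_of_le zero_le_one] at hx
  exact ⟨lt_of_le_of_ne hx.1 (Ne.symm hx0), lt_of_le_of_ne hx.2 hx1⟩

/-- The difference of `u` and the integral of `f` is absolutely continuous with derivative zero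
almost everywhere, hence constant. The sum and product rules are derived from this. -/
theorem isPrimitive_of_absolutelyContinuous {u f : ℝ → 𝕜}
    (hu : AbsolutelyContinuousOnInterval u 0 1) (hf : IntervalIntegrable f volume 0 1)
    (hd : ∀ᵐ x, x ∈ Ioo (0 : ℝ) 1 → HasDerivAt u (f x) x) : IsPrimitive u f := by
  refine ⟨hf, fun x hx => ?_⟩
  have h1 := hu.sub (absolutelyContinuousOnInterval_integral hf)
  obtain ⟨C, hC⟩ := h1.const_of_ae_hasDerivAt_zero (by
    filter_upwards [hd, hf.ae_hasDerivAt_integral, ae_mem_Ioo_of_mem_uIcc] with y h2 h3 h4 h5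
    simpa using (h2 (h4 h5)).sub (h3 h5 0 (by simp)))
  have e0 := hC 0 (by simp)
  have e1 := hC x (by rwa [uIcc_of_le zero_le_one])
  simp only [Pi.sub_apply, intervalIntegral.integral_same, sub_zero] at e0 e1
  rw [e0, ← e1]; ring

theorem isPrimitive_of_hasDerivAt {u f : ℝ → 𝕜} (hd : ∀ x, HasDerivAt u (f x) x)
    (hf : Continuous f) : IsPrimitive u f := by
  refine ⟨hf.intervalIntegrable _ _, fun x _ => ?_⟩
  rw [intervalIntegral.integral_eq_sub_of_hasDerivAt (fun y _ => hd y)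
    (hf.intervalIntegrable _ _)]
  ring

theorem IsPrimitive.congr {u v f g : ℝ → 𝕜} (h : IsPrimitive u f) (huv : EqOn u v (Icc 0 1))
    (hfg : ∀ᵐ x, x ∈ Ioo (0 : ℝ) 1 → f x = g x) : IsPrimitive v g := by
  refine isPrimitive_of_absolutelyContinuous
    (absolutelyContinuousOnInterval_congr huv h.absolutelyContinuous) ?_ ?_
  · refine h.intervalIntegrable.congr_ae ?_
    rw [EventuallyEq, ae_restrict_iff' measurableSet_uIoc]
    filter_upwards [hfg, ae_mem_Ioo_of_mem_uIcc] with x hx hx2 hx3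
    exact hx (hx2 (uIoc_subset_uIcc hx3))
  · filter_upwards [hfg, h.ae_hasDerivAt] with x hx hx2 hx3
    rw [← hx hx3]
    refine (hx2 hx3).congr_of_eventuallyEq ?_
    filter_upwards [Icc_mem_nhds hx3.1 hx3.2] with y hy using (huv hy).symm

theorem IsPrimitive.mul {u v f g : ℝ → 𝕜} (hu : IsPrimitive u f) (hv : IsPrimitive v g) :
    IsPrimitive (fun x => u x * v x) (fun x => f x * v x + u x * g x) := by
  have cu : ContinuousOn u (uIcc 0 1) := hu.absolutelyContinuous.continuousOn
  have cv : ContinuousOn v (uIcc 0 1) := hv.absolutelyContinuous.continuousOn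
  refine isPrimitive_of_absolutelyContinuous (hu.absolutelyContinuous.smul hv.absolutelyContinuous)
    ((hu.intervalIntegrable.mul_continuousOn cv).add
      (hv.intervalIntegrable.continuousOn_mul cu)) ?_
  filter_upwards [hu.ae_hasDerivAt, hv.ae_hasDerivAt] with x h1 h2 h3
  exact (h1 h3).mul (h2 h3)

theorem IsPrimitive.add {u v f g : ℝ → 𝕜} (hu : IsPrimitive u f) (hv : IsPrimitive v g) :
    IsPrimitive (fun x => u x + v x) (fun x => f x + g x) := by
  refine isPrimitive_of_absolutelyContinuous (hu.absolutelyContinuous.add hv.absolutelyContinuous)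
    (hu.intervalIntegrable.add hv.intervalIntegrable) ?_
  filter_upwards [hu.ae_hasDerivAt, hv.ae_hasDerivAt] with x h1 h2 h3
  exact (h1 h3).add (h2 h3)

theorem isPrimitive_const (c : 𝕜) : IsPrimitive (fun _ => c) (fun _ => 0) :=
  isPrimitive_of_hasDerivAt (fun x => hasDerivAt_const x c) continuous_const

theorem IsPrimitive.const_mul {u f : ℝ → 𝕜} (c : 𝕜) (hu : IsPrimitive u f) :
    IsPrimitive (fun x => c * u x) (fun x => c * f x) := by
  simpa using (isPrimitive_const c).mul hu

theorem IsPrimitive.sub {u v f g : ℝ → 𝕜} (hu : IsPrimitive u f) (hv : IsPrimitive v g) :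
    IsPrimitive (fun x => u x - v x) (fun x => f x - g x) := by
  simpa [sub_eq_add_neg] using hu.add (hv.const_mul (-1))

theorem IsPrimitive.pow {u f : ℝ → 𝕜} (hu : IsPrimitive u f) (n : ℕ) :
    IsPrimitive (fun x => u x ^ (n + 1)) (fun x => (n + 1) * (u x ^ n * f x)) := by
  induction n with
  | zero => simpa using hu
  | succ n ih =>
    refine (ih.mul hu).congr (fun x _ => by simp [pow_succ]) (Eventually.of_forall fun x _ => ?_)
    push_cast; ring

/-- The mirror image of a primitive. -/
theorem IsPrimitive.reflect {u f : ℝ → 𝕜} (hu : IsPrimitive u f) :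
    IsPrimitive (fun x => u (1 - x)) (fun x => -f (1 - x)) := by
  have hi : IntervalIntegrable (fun x => f (1 - x)) volume 0 1 := by
    have := (hu.intervalIntegrable.comp_sub_left 1).symm
    simpa using this
  refine ⟨hi.neg, fun x hx => ?_⟩
  have hx' : 1 - x ∈ Icc (0 : ℝ) 1 := ⟨by linarith [hx.2], by linarith [hx.1]⟩
  have e : ∫ t in (0 : ℝ)..x, -f (1 - t) = -∫ t in (1 - x)..1, f t := by
    rw [intervalIntegral.integral_neg, intervalIntegral.integral_comp_sub_left]
    simp
  have h1 : (1 : ℝ) ∈ Icc (0 : ℝ) 1 := by simp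
  have h0 : (0 : ℝ) ∈ Icc (0 : ℝ) 1 := by simp
  rw [e, sub_zero, hu.eq_add_integral _ hx', hu.eq_add_integral 1 h1,
    ← intervalIntegral.integral_add_adjacent_intervals
      (intervalIntegrable_of_mem hu.intervalIntegrable h0 hx')
      (intervalIntegrable_of_mem hu.intervalIntegrable hx' h1)]
  ring

theorem IsPrimitive.hasDerivWithinAt {u f : ℝ → 𝕜} (hu : IsPrimitive u f)
    (hf : ContinuousOn f (Icc 0 1)) {x : ℝ} (hx : x ∈ Icc (0 : ℝ) 1) :
    HasDerivWithinAt u (f x) (Icc 0 1) x := by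
  have : Fact (x ∈ Icc (0 : ℝ) 1) := ⟨hx⟩
  have h0 : (0 : ℝ) ∈ Icc (0 : ℝ) 1 := by simp
  have := intervalIntegral.integral_hasDerivWithinAt_right
    (intervalIntegrable_of_mem hu.intervalIntegrable h0 hx) (s := Icc (0 : ℝ) 1)
    (t := Icc (0 : ℝ) 1)
    (hf.stronglyMeasurableAtFilter_nhdsWithin measurableSet_Icc x) (hf x hx)
  exact (this.const_add (u 0)).congr (fun y hy => hu.eq_add_integral y hy)
    (hu.eq_add_integral x hx)

end Primitive

/-! ### The initial value problem -/

section InitialValue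

open BoundedContinuousFunction

variable {𝕜 : Type*} [RCLike 𝕜]

/-- `1 - T ^ n` is the product of `1 - T` and a geometric sum commuting with it, so both factors are
invertible. -/
theorem isUnit_one_sub_of_norm_pow_lt_one {E : Type*} [NormedAddCommGroup E] [NormedSpace 𝕜 E]
    [CompleteSpace E] {T : E →L[𝕜] E} {n : ℕ} (h : ‖T ^ n‖ < 1) : IsUnit (1 - T) := by
  have h1 : IsUnit (1 - T ^ n) := isUnit_one_sub_of_norm_lt_one h
  have hcomm : Commute (1 - T) (∑ i ∈ Finset.range n, T ^ i) :=
    (Commute.one_left _).sub_left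
      (Commute.sum_right _ _ _ fun i _ => Commute.pow_right (Commute.refl _) i)
  rw [← mul_neg_geom_sum, hcomm.isUnit_mul_iff] at h1
  exact h1.1

/-- Inversion is differentiable at units. All analyticity in the spectral parameter rests on this.
-/
theorem differentiable_inverse_apply {E : Type*} [NormedAddCommGroup E] [NormedSpace 𝕜 E]
    [CompleteSpace E] (J A B : E →L[𝕜] E) (v : E) (h : ∀ l : 𝕜, IsUnit (1 - J * (A - l • B))) :
    Differentiable 𝕜 fun l : 𝕜 => Ring.inverse (1 - J * (A - l • B)) v := by
  intro l
  have h1 : Differentiable 𝕜 fun l : 𝕜 => 1 - J * (A - l • B) := by fun_prop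
  have h2 : DifferentiableAt 𝕜 (fun l : 𝕜 => Ring.inverse (1 - J * (A - l • B))) l :=
    DifferentiableAt.comp (g := Ring.inverse) l (differentiableAt_inverse (h l)) (h1 l)
  exact h2.clm_apply (differentiableAt_const _)

theorem differentiable_sub_smul_apply {E : Type*} [NormedAddCommGroup E] [NormedSpace 𝕜 E]
    (A B : E →L[𝕜] E) {u : 𝕜 → E} (hu : Differentiable 𝕜 u) :
    Differentiable 𝕜 fun l : 𝕜 => (A - l • B) (u l) := by
  fun_prop

/-- `y` solves `-y'' + q y = l y` on `[0,1]` and `y'` is its derivative. -/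
structure IsSolution (q : ℝ → 𝕜) (l : 𝕜) (y y' : ℝ → 𝕜) : Prop where
  isPrimitive : IsPrimitive y y'
  isPrimitive_deriv : IsPrimitive y' (fun x => (q x - l) * y x)

theorem intervalIntegrable_mul_IccExtend {f : ℝ → 𝕜} (hf : IntervalIntegrable f volume 0 1)
    (g : Icc (0 : ℝ) 1 →ᵇ 𝕜) :
    IntervalIntegrable (fun t => f t * IccExtend zero_le_one g t) volume 0 1 :=
  hf.mul_continuousOn g.continuous.Icc_extend'.continuousOn

theorem isPrimitive_integral {f : ℝ → 𝕜} (hf : IntervalIntegrable f volume 0 1) :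
    IsPrimitive (fun x => ∫ t in (0 : ℝ)..x, f t) f :=
  ⟨hf, fun x _ => by simp⟩

theorem norm_integral_mul_le {f : ℝ → 𝕜} (hf : IntervalIntegrable f volume 0 1)
    {g : ℝ → 𝕜} {k : ℝ → ℝ} (hk : ContinuousOn k (Icc 0 1))
    (hgk : ∀ t ∈ Icc (0 : ℝ) 1, ‖g t‖ ≤ k t) {x : ℝ} (hx : x ∈ Icc (0 : ℝ) 1) :
    ‖∫ t in (0 : ℝ)..x, f t * g t‖ ≤ ∫ t in (0 : ℝ)..x, ‖f t‖ * k t := by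
  have h0 : (0 : ℝ) ∈ Icc (0 : ℝ) 1 := by simp
  refine intervalIntegral.norm_integral_le_of_norm_le hx.1 (Eventually.of_forall fun t ht => ?_)
    (intervalIntegrable_of_mem (hf.norm.mul_continuousOn (by
      rwa [uIcc_of_le zero_le_one])) h0 hx)
  rw [norm_mul]
  exact mul_le_mul_of_nonneg_left (hgk t ⟨ht.1.le, ht.2.trans hx.2⟩) (norm_nonneg _)

theorem integral_norm_le {f : ℝ → 𝕜} (hf : IntervalIntegrable f volume 0 1)
    {x : ℝ} (hx : x ∈ Icc (0 : ℝ) 1) :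
    ∫ t in (0 : ℝ)..x, ‖f t‖ ≤ ∫ t in (0 : ℝ)..1, ‖f t‖ :=
  intervalIntegral.integral_mono_interval le_rfl hx.1 hx.2
    (Eventually.of_forall fun _ => norm_nonneg _) hf.norm

/-- The operator `g ↦ ∫₀ˣ f g` on `C[0,1]`. -/
noncomputable def volterra {f : ℝ → 𝕜} (hf : IntervalIntegrable f volume 0 1) :
    (Icc (0 : ℝ) 1 →ᵇ 𝕜) →L[𝕜] (Icc (0 : ℝ) 1 →ᵇ 𝕜) :=
  LinearMap.mkContinuous
    { toFun := fun g => mkOfCompact ⟨fun x => ∫ t in (0 : ℝ)..x, f t * IccExtend zero_le_one g t,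
        (isPrimitive_integral (intervalIntegrable_mul_IccExtend hf g)).continuousOn.comp_continuous
          continuous_subtype_val fun x => x.2⟩
      map_add' := fun g₁ g₂ => by
        ext x
        have h0 : (0 : ℝ) ∈ Icc (0 : ℝ) 1 := by simp
        simp only [mkOfCompact_apply, ContinuousMap.coe_mk, BoundedContinuousFunction.add_apply]
        rw [← intervalIntegral.integral_add
          (intervalIntegrable_of_mem (intervalIntegrable_mul_IccExtend hf g₁) h0 x.2)
          (intervalIntegrable_of_mem (intervalIntegrable_mul_IccExtend hf g₂) h0 x.2)]
        simp [IccExtend, mul_add]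
      map_smul' := fun c g => by
        ext x
        simp only [mkOfCompact_apply, ContinuousMap.coe_mk, BoundedContinuousFunction.smul_apply,
          RingHom.id_apply, smul_eq_mul]
        rw [← intervalIntegral.integral_const_mul]
        congr 1
        ext t
        simp [IccExtend]
        ring }
    (∫ t in (0 : ℝ)..1, ‖f t‖)
    (fun g => by
      have hI : 0 ≤ ∫ t in (0 : ℝ)..1, ‖f t‖ :=
        intervalIntegral.integral_nonneg zero_le_one fun _ _ => norm_nonneg _
      refine (BoundedContinuousFunction.norm_le (mul_nonneg hI (norm_nonneg g))).2 fun x => ?_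
      refine (norm_integral_mul_le hf (k := fun _ => ‖g‖) continuousOn_const
        (fun t _ => g.norm_coe_le_norm _) x.2).trans ?_
      rw [intervalIntegral.integral_mul_const]
      exact mul_le_mul_of_nonneg_right (integral_norm_le hf x.2) (norm_nonneg _))

theorem volterra_apply {f : ℝ → 𝕜} (hf : IntervalIntegrable f volume 0 1)
    (g : Icc (0 : ℝ) 1 →ᵇ 𝕜) (x : Icc (0 : ℝ) 1) :
    volterra hf g x = ∫ t in (0 : ℝ)..x, f t * IccExtend zero_le_one g t := rfl

theorem intervalIntegrable_one : IntervalIntegrable (fun _ : ℝ => (1 : 𝕜)) volume 0 1 :=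
  intervalIntegrable_const

theorem intervalIntegrable_sub_const {q : ℝ → 𝕜} (hq : IntervalIntegrable q volume 0 1) (l : 𝕜) :
    IntervalIntegrable (fun x => q x - l) volume 0 1 :=
  hq.sub intervalIntegrable_const

theorem volterra_sub_const {q : ℝ → 𝕜} (hq : IntervalIntegrable q volume 0 1) (l : 𝕜) :
    volterra (intervalIntegrable_sub_const hq l)
      = volterra hq - l • volterra intervalIntegrable_one := by
  ext g x
  have h0 : (0 : ℝ) ∈ Icc (0 : ℝ) 1 := by simp
  simp only [_root_.sub_apply, BoundedContinuousFunction.sub_apply,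
    _root_.smul_apply, BoundedContinuousFunction.smul_apply, volterra_apply, smul_eq_mul]
  rw [← intervalIntegral.integral_const_mul, ← intervalIntegral.integral_sub
    (intervalIntegrable_of_mem (intervalIntegrable_mul_IccExtend hq g) h0 x.2)
    ((intervalIntegrable_of_mem (intervalIntegrable_mul_IccExtend
      intervalIntegrable_one g) h0 x.2).const_mul l)]
  congr 1
  ext t
  ring

/-- The integral operator of the initial value problem for `-y'' + q y = l y`. -/
noncomputable def picard {q : ℝ → 𝕜} (hq : IntervalIntegrable q volume 0 1) (l : 𝕜) :
    (Icc (0 : ℝ) 1 →ᵇ 𝕜) →L[𝕜] (Icc (0 : ℝ) 1 →ᵇ 𝕜) :=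
  volterra intervalIntegrable_one * (volterra hq - l • volterra intervalIntegrable_one)

/-- With `K(x) = ∫₀ˣ ‖q - l‖`, the inner integral turns `Kⁿ K'/n!` into `Kⁿ⁺¹/(n+1)!`. The outer
integral runs over a length at most `1` and `K` is monotone, so the bound survives it. The factorial
makes some power of the operator a contraction for every `l`. -/
theorem norm_picard_pow_apply_le {q : ℝ → 𝕜} (hq : IntervalIntegrable q volume 0 1) (l : 𝕜)
    (g : Icc (0 : ℝ) 1 →ᵇ 𝕜) (n : ℕ) (x : Icc (0 : ℝ) 1) :
    ‖(picard hq l ^ n) g x‖ ≤ ‖g‖ * (∫ t in (0 : ℝ)..x, ‖q t - l‖) ^ n / n.factorial := by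
  induction n generalizing x with
  | zero => simpa using g.norm_coe_le_norm x
  | succ n ih =>
    have hk := intervalIntegrable_sub_const hq l
    have hK := isPrimitive_integral hk.norm
    set K : ℝ → ℝ := fun x => ∫ t in (0 : ℝ)..x, ‖q t - l‖ with hKdef
    have hKmono : ∀ s ∈ Icc (0 : ℝ) 1, ∀ x ∈ Icc (0 : ℝ) 1, s ≤ x → K s ≤ K x := by
      intro s hs x hx hsx
      have h0 : (0 : ℝ) ∈ Icc (0 : ℝ) 1 := by simp
      exact intervalIntegral.integral_mono_interval le_rfl hs.1 hsx
        (Eventually.of_forall fun _ => norm_nonneg _)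
        (intervalIntegrable_of_mem hk.norm h0 hx)
    have hK0 : ∀ s ∈ Icc (0 : ℝ) 1, 0 ≤ K s := fun s hs =>
      intervalIntegral.integral_nonneg hs.1 fun _ _ => norm_nonneg _
    set h := (picard hq l ^ n) g with hh
    have hstep : ∀ x ∈ Icc (0 : ℝ) 1,
        ‖∫ t in (0 : ℝ)..x, (q t - l) * IccExtend zero_le_one h t‖
          ≤ ‖g‖ * K x ^ (n + 1) / (n + 1).factorial := by
      intro x hx
      refine (norm_integral_mul_le hk (k := fun t => ‖g‖ / n.factorial * K t ^ n)
        (continuousOn_const.mul (hK.continuousOn.pow n)) (fun t ht => ?_) hx).trans (le_of_eq ?_)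
      · rw [IccExtend_of_mem _ _ ht]
        refine (ih ⟨t, ht⟩).trans (le_of_eq ?_)
        simp only [hKdef]; ring
      · have e := (hK.pow n).eq_add_integral x hx
        have e0 : K 0 = 0 := by simp [hKdef]
        rw [e0, intervalIntegral.integral_const_mul] at e
        have e2 : (fun t => ‖q t - l‖ * (‖g‖ / n.factorial * K t ^ n))
            = fun t => ‖g‖ / n.factorial * (K t ^ n * ‖q t - l‖) := by ext t; ring
        rw [e2, intervalIntegral.integral_const_mul, Nat.factorial_succ, e]
        push_cast
        have : (n.factorial : ℝ) ≠ 0 := by positivity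
        have : (n + 1 : ℝ) ≠ 0 := by positivity
        rw [zero_pow (Nat.succ_ne_zero n), zero_add]
        field_simp
    rw [pow_succ', mul_apply_eq_comp, ← hh, picard, ← volterra_sub_const,
      mul_apply_eq_comp, volterra_apply]
    have hb : ∀ t ∈ uIoc (0 : ℝ) x, ‖(1 : 𝕜) * IccExtend zero_le_one (volterra hk h) t‖
        ≤ ‖g‖ * K x ^ (n + 1) / (n + 1).factorial := by
      intro t ht
      rw [uIoc_of_le x.2.1] at ht
      have ht' : t ∈ Icc (0 : ℝ) 1 := ⟨ht.1.le, ht.2.trans x.2.2⟩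
      rw [one_mul, IccExtend_of_mem _ _ ht', volterra_apply]
      refine (hstep t ht').trans ?_
      have := hK0 t ht'
      have := hKmono t ht' x x.2 ht.2
      gcongr
    refine (intervalIntegral.norm_integral_le_of_norm_le_const hb).trans ?_
    have hx1 : |(x : ℝ) - 0| ≤ 1 := by
      rw [sub_zero, abs_of_nonneg x.2.1]; exact x.2.2
    have := hK0 x x.2
    exact mul_le_of_le_one_right (by positivity) hx1

theorem isUnit_one_sub_picard {q : ℝ → 𝕜} (hq : IntervalIntegrable q volume 0 1) (l : 𝕜) :
    IsUnit (1 - picard hq l) := by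
  have hI : 0 ≤ ∫ t in (0 : ℝ)..1, ‖q t - l‖ :=
    intervalIntegral.integral_nonneg zero_le_one fun _ _ => norm_nonneg _
  obtain ⟨n, hn⟩ := ((FloorSemiring.tendsto_pow_div_factorial_atTop
    (∫ t in (0 : ℝ)..1, ‖q t - l‖)).eventually (gt_mem_nhds one_pos)).exists
  have hlt : ‖picard hq l ^ n‖ < 1 := by
    refine lt_of_le_of_lt (ContinuousLinearMap.opNorm_le_bound _ (by positivity) fun g => ?_) hn
    refine (BoundedContinuousFunction.norm_le (by positivity)).2 fun x => ?_
    refine (norm_picard_pow_apply_le hq l g n x).trans ?_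
    have h1 := integral_norm_le (intervalIntegrable_sub_const hq l) x.2
    have h0 : 0 ≤ ∫ t in (0 : ℝ)..x, ‖q t - l‖ :=
      intervalIntegral.integral_nonneg x.2.1 fun _ _ => norm_nonneg _
    rw [mul_div_assoc, mul_comm]
    gcongr
  exact isUnit_one_sub_of_norm_pow_lt_one hlt

/-- The function `a + c x` on `[0,1]`. -/
noncomputable def affine (a c : 𝕜) : (Icc (0 : ℝ) 1 →ᵇ 𝕜) :=
  mkOfCompact ⟨fun x => a + c * ((x : ℝ) : 𝕜), by fun_prop⟩

/-- The solution with `y(0) = a`, `y'(0) = c`, as an element of `C[0,1]`. -/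
noncomputable def solutionMap {q : ℝ → 𝕜} (hq : IntervalIntegrable q volume 0 1) (a c l : 𝕜) :
    Icc (0 : ℝ) 1 →ᵇ 𝕜 :=
  Ring.inverse (1 - picard hq l) (affine a c)

/-- The derivative of `solutionMap`. -/
noncomputable def solutionDerivMap {q : ℝ → 𝕜} (hq : IntervalIntegrable q volume 0 1) (a c l : 𝕜) :
    Icc (0 : ℝ) 1 →ᵇ 𝕜 :=
  affine c 0 + volterra (intervalIntegrable_sub_const hq l) (solutionMap hq a c l)

/-- The solution of `-y'' + q y = l y` with `y(0) = a`, `y'(0) = c`. -/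
noncomputable def solution {q : ℝ → 𝕜} (hq : IntervalIntegrable q volume 0 1) (a c l : 𝕜) :
    ℝ → 𝕜 := IccExtend zero_le_one (solutionMap hq a c l)

/-- The derivative of `solution`. -/
noncomputable def solutionDeriv {q : ℝ → 𝕜} (hq : IntervalIntegrable q volume 0 1) (a c l : 𝕜) :
    ℝ → 𝕜 := IccExtend zero_le_one (solutionDerivMap hq a c l)

theorem solutionMap_eq_affine_add {q : ℝ → 𝕜} (hq : IntervalIntegrable q volume 0 1) (a c l : 𝕜) :
    solutionMap hq a c l = affine a c + picard hq l (solutionMap hq a c l) := by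
  have h := Ring.mul_inverse_cancel _ (isUnit_one_sub_picard hq l)
  have h2 : (1 - picard hq l) (solutionMap hq a c l) = affine a c := by
    rw [solutionMap, ← mul_apply_eq_comp, h]; rfl
  rw [_root_.sub_apply, one_apply_eq_self] at h2
  rw [← h2]; abel

theorem eq_solutionMap {q : ℝ → 𝕜} (hq : IntervalIntegrable q volume 0 1) {a c l : 𝕜}
    {g : (Icc (0 : ℝ) 1 →ᵇ 𝕜)} (hg : g = affine a c + picard hq l g) :
    g = solutionMap hq a c l := by
  have h := Ring.inverse_mul_cancel _ (isUnit_one_sub_picard hq l)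
  have h2 : (1 - picard hq l) g = affine a c := by
    rw [_root_.sub_apply, one_apply_eq_self]
    nth_rewrite 1 [hg]; abel
  rw [solutionMap, ← h2, ← mul_apply_eq_comp, h]; rfl

theorem solutionDeriv_eq {q : ℝ → 𝕜} (hq : IntervalIntegrable q volume 0 1) (a c l : 𝕜)
    {x : ℝ} (hx : x ∈ Icc (0 : ℝ) 1) :
    solutionDeriv hq a c l x = c + ∫ t in (0 : ℝ)..x, (q t - l) * solution hq a c l t := by
  rw [solutionDeriv, IccExtend_of_mem _ _ hx, solutionDerivMap,
    BoundedContinuousFunction.add_apply, volterra_apply]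
  simp [affine, solution]

theorem solution_eq {q : ℝ → 𝕜} (hq : IntervalIntegrable q volume 0 1) (a c l : 𝕜)
    {x : ℝ} (hx : x ∈ Icc (0 : ℝ) 1) :
    solution hq a c l x = a + ∫ t in (0 : ℝ)..x, solutionDeriv hq a c l t := by
  have h0 : (0 : ℝ) ∈ Icc (0 : ℝ) 1 := by simp
  rw [solution, IccExtend_of_mem _ _ hx, solutionMap_eq_affine_add,
    BoundedContinuousFunction.add_apply,
    picard, ← volterra_sub_const, mul_apply_eq_comp, volterra_apply]
  have e : ∀ t, solutionDeriv hq a c l t = c + (1 : 𝕜) * IccExtend zero_le_one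
      (volterra (intervalIntegrable_sub_const hq l) (solutionMap hq a c l)) t := by
    intro t
    simp [solutionDeriv, IccExtend, solutionDerivMap, affine]
  simp_rw [e]
  rw [intervalIntegral.integral_add intervalIntegrable_const
    (intervalIntegrable_of_mem (intervalIntegrable_mul_IccExtend
      intervalIntegrable_one _) h0 hx)]
  simp only [affine, mkOfCompact_apply, ContinuousMap.coe_mk, intervalIntegral.integral_const,
    sub_zero,
    RCLike.real_smul_eq_coe_mul]
  ring

theorem solution_zero {q : ℝ → 𝕜} (hq : IntervalIntegrable q volume 0 1) (a c l : 𝕜) :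
    solution hq a c l 0 = a := by
  rw [solution_eq hq a c l (by simp)]; simp

theorem solutionDeriv_zero {q : ℝ → 𝕜} (hq : IntervalIntegrable q volume 0 1) (a c l : 𝕜) :
    solutionDeriv hq a c l 0 = c := by
  rw [solutionDeriv_eq hq a c l (by simp)]; simp

theorem continuous_solution {q : ℝ → 𝕜} (hq : IntervalIntegrable q volume 0 1) (a c l : 𝕜) :
    Continuous (solution hq a c l) :=
  (solutionMap hq a c l).continuous.Icc_extend'

theorem continuous_solutionDeriv {q : ℝ → 𝕜} (hq : IntervalIntegrable q volume 0 1) (a c l : 𝕜) :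
    Continuous (solutionDeriv hq a c l) :=
  (solutionDerivMap hq a c l).continuous.Icc_extend'

theorem isSolution_solution {q : ℝ → 𝕜} (hq : IntervalIntegrable q volume 0 1) (a c l : 𝕜) :
    IsSolution q l (solution hq a c l) (solutionDeriv hq a c l) where
  isPrimitive := ⟨(continuous_solutionDeriv hq a c l).intervalIntegrable _ _, fun x hx => by
    rw [solution_zero, solution_eq hq a c l hx]⟩
  isPrimitive_deriv := ⟨(intervalIntegrable_sub_const hq l).mul_continuousOn
      (continuous_solution hq a c l).continuousOn, fun x hx => by
    rw [solutionDeriv_zero, solutionDeriv_eq hq a c l hx]⟩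

/-- The restriction of any solution to `[0,1]` satisfies the same fixed point equation in `C[0,1]`,
and `1 - picard hq l` is injective. -/
theorem IsSolution.eq_solution {q : ℝ → 𝕜} (hq : IntervalIntegrable q volume 0 1) {l : 𝕜}
    {y y' : ℝ → 𝕜} (hy : IsSolution q l y y') {x : ℝ} (hx : x ∈ Icc (0 : ℝ) 1) :
    y x = solution hq (y 0) (y' 0) l x := by
  have h0 : (0 : ℝ) ∈ Icc (0 : ℝ) 1 := by simp
  set g : (Icc (0 : ℝ) 1 →ᵇ 𝕜) := mkOfCompact ⟨fun x => y x,
    hy.isPrimitive.continuousOn.comp_continuous continuous_subtype_val fun x => x.2⟩ with hgdef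
  have hext : ∀ t ∈ Icc (0 : ℝ) 1, IccExtend zero_le_one g t = y t := fun t ht => by
    rw [IccExtend_of_mem _ _ ht]; rfl
  have hg : g = affine (y 0) (y' 0) + picard hq l g := by
    ext x
    rw [BoundedContinuousFunction.add_apply, picard, mul_apply_eq_comp, volterra_apply,
      ← volterra_sub_const]
    have e : ∫ t in (0 : ℝ)..x, (1 : 𝕜) * IccExtend zero_le_one
        (volterra (intervalIntegrable_sub_const hq l) g) t
        = ∫ t in (0 : ℝ)..x, (y' t - y' 0) := by
      refine intervalIntegral.integral_congr fun t ht => ?_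
      rw [uIcc_of_le x.2.1] at ht
      have ht' : t ∈ Icc (0 : ℝ) 1 := ⟨ht.1, ht.2.trans x.2.2⟩
      simp only [one_mul]
      rw [IccExtend_of_mem _ _ ht', volterra_apply, hy.isPrimitive_deriv.eq_add_integral t ht',
        add_sub_cancel_left]
      refine intervalIntegral.integral_congr fun s hs => ?_
      rw [uIcc_of_le ht.1] at hs
      rw [hext s ⟨hs.1, hs.2.trans ht'.2⟩]
    rw [e, intervalIntegral.integral_sub
      (intervalIntegrable_of_mem hy.isPrimitive.intervalIntegrable h0 x.2)
      intervalIntegrable_const]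
    have := hy.isPrimitive.eq_add_integral x x.2
    simp only [affine, mkOfCompact_apply, ContinuousMap.coe_mk, intervalIntegral.integral_const,
    sub_zero,
      RCLike.real_smul_eq_coe_mul, hgdef]
    rw [this]; ring
  rw [solution, IccExtend_of_mem _ _ hx, ← eq_solutionMap hq hg]
  rfl

theorem IsSolution.eq_solutionDeriv {q : ℝ → 𝕜} (hq : IntervalIntegrable q volume 0 1) {l : 𝕜}
    {y y' : ℝ → 𝕜} (hy : IsSolution q l y y') {x : ℝ} (hx : x ∈ Icc (0 : ℝ) 1) :
    y' x = solutionDeriv hq (y 0) (y' 0) l x := by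
  rw [solutionDeriv_eq _ _ _ _ hx, hy.isPrimitive_deriv.eq_add_integral x hx]
  congr 1
  refine intervalIntegral.integral_congr fun t ht => ?_
  rw [uIcc_of_le hx.1] at ht
  rw [hy.eq_solution hq ⟨ht.1, ht.2.trans hx.2⟩]

theorem differentiable_solutionMap {q : ℝ → 𝕜} (hq : IntervalIntegrable q volume 0 1) (a c : 𝕜) :
    Differentiable 𝕜 (solutionMap hq a c) :=
  differentiable_inverse_apply _ _ _ _ (isUnit_one_sub_picard hq)

theorem differentiable_eval {F : 𝕜 → (Icc (0 : ℝ) 1 →ᵇ 𝕜)} (hF : Differentiable 𝕜 F)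
    (x : Icc (0 : ℝ) 1) : Differentiable 𝕜 fun l => F l x :=
  let e : (Icc (0 : ℝ) 1 →ᵇ 𝕜) →L[𝕜] 𝕜 := BoundedContinuousFunction.evalCLM 𝕜 x
  e.differentiable.comp hF

theorem differentiable_solution {q : ℝ → 𝕜} (hq : IntervalIntegrable q volume 0 1) (a c : 𝕜)
    (x : ℝ) : Differentiable 𝕜 fun l => solution hq a c l x :=
  differentiable_eval (differentiable_solutionMap hq a c) _

theorem differentiable_solutionDeriv {q : ℝ → 𝕜} (hq : IntervalIntegrable q volume 0 1) (a c : 𝕜)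
    (x : ℝ) : Differentiable 𝕜 fun l => solutionDeriv hq a c l x := by
  refine differentiable_eval (F := solutionDerivMap hq a c) ?_ _
  have h := differentiable_sub_smul_apply (volterra hq) (volterra intervalIntegrable_one)
    (differentiable_solutionMap hq a c)
  simp_rw [← volterra_sub_const hq] at h
  exact (differentiable_const (affine c 0)).add h

end InitialValue

/-! ### Asymptotics for large spectral parameter -/

section Asymptotics

theorem norm_exp_mul_ofReal_le {ω : ℂ} {τ : ℝ} (hω : |ω.re| ≤ τ) {s : ℝ} (hs : 0 ≤ s) :
    ‖Complex.exp (ω * s)‖ ≤ Real.exp (τ * s) := by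
  rw [Complex.norm_exp, Real.exp_le_exp]
  simpa using mul_le_mul_of_nonneg_right ((le_abs_self _).trans hω) hs

theorem norm_cos_le (w : ℂ) : ‖Complex.cos w‖ ≤ Real.exp |w.im| := by
  have h1 : ‖Complex.exp (w * Complex.I)‖ ≤ Real.exp |w.im| := by
    rw [Complex.norm_exp, Real.exp_le_exp]; simpa using neg_le_abs w.im
  have h2 : ‖Complex.exp (-w * Complex.I)‖ ≤ Real.exp |w.im| := by
    rw [Complex.norm_exp, Real.exp_le_exp]; simpa using le_abs_self w.im
  rw [Complex.cos, norm_div, Complex.norm_ofNat]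
  linarith [norm_add_le (Complex.exp (w * Complex.I)) (Complex.exp (-w * Complex.I))]

theorem norm_sin_le (w : ℂ) : ‖Complex.sin w‖ ≤ Real.exp |w.im| := by
  have h1 : ‖Complex.exp (w * Complex.I)‖ ≤ Real.exp |w.im| := by
    rw [Complex.norm_exp, Real.exp_le_exp]; simpa using neg_le_abs w.im
  have h2 : ‖Complex.exp (-w * Complex.I)‖ ≤ Real.exp |w.im| := by
    rw [Complex.norm_exp, Real.exp_le_exp]; simpa using le_abs_self w.im
  rw [Complex.sin, norm_div, Complex.norm_ofNat, norm_mul, Complex.norm_I, mul_one]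
  linarith [norm_sub_le (Complex.exp (-w * Complex.I)) (Complex.exp (w * Complex.I))]

theorem abs_im_mul_ofReal (z : ℂ) {x : ℝ} (hx : 0 ≤ x) : |(z * x).im| = |z.im| * x := by
  simp [abs_mul, abs_of_nonneg hx]

variable {q : ℝ → ℂ} {y y' : ℝ → ℂ} {z : ℂ}

/-- Since `ω² = -z²`, the equation factors as `(d/dx - ω)(y' + ω y) = q y`; this is a first-order
equation with integrating factor `e^{-ωx}`. -/
theorem IsSolution.deriv_add_mul_eq (hy : IsSolution q (z ^ 2) y y') {ω : ℂ} (hω : ω ^ 2 = -z ^ 2)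
    {x : ℝ} (hx : x ∈ Icc (0 : ℝ) 1) :
    y' x + ω * y x - Complex.exp (ω * x) * (y' 0 + ω * y 0)
      = ∫ t in (0 : ℝ)..x, q t * (Complex.exp (ω * (x - t : ℝ)) * y t) := by
  have he : IsPrimitive (fun x : ℝ => Complex.exp (-ω * x))
      (fun x : ℝ => Complex.exp (-ω * x) * -ω) := by
    refine isPrimitive_of_hasDerivAt (fun x => ?_) (by fun_prop)
    have h1 : HasDerivAt (fun x : ℝ => -ω * (x : ℂ)) (-ω) x := by
      simpa using (Complex.ofRealCLM.hasDerivAt (x := x)).const_mul (-ω)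
    exact h1.cexp
  have h := he.mul (hy.isPrimitive_deriv.add (hy.isPrimitive.const_mul ω))
  have h2 := h.congr (g := fun t => Complex.exp (-ω * t) * (q t * y t)) (fun _ _ => rfl)
    (Eventually.of_forall fun t _ => by linear_combination (-Complex.exp (-ω * t) * y t) * hω)
  have e := h2.eq_add_integral x hx
  have e1 : Complex.exp (ω * x) * Complex.exp (-ω * x) = 1 := by
    rw [← Complex.exp_add]; simp
  have e2 : ∫ t in (0 : ℝ)..x, q t * (Complex.exp (ω * (x - t : ℝ)) * y t)
      = Complex.exp (ω * x) * ∫ t in (0 : ℝ)..x, Complex.exp (-ω * t) * (q t * y t) := by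
    rw [← intervalIntegral.integral_const_mul]
    congr 1
    ext t
    have : Complex.exp (ω * (x - t : ℝ)) = Complex.exp (ω * x) * Complex.exp (-ω * t) := by
      rw [← Complex.exp_add]; push_cast; ring_nf
    rw [this]; ring
  rw [e2]
  simp only [Complex.ofReal_zero, mul_zero, Complex.exp_zero, one_mul] at e
  linear_combination Complex.exp (ω * x) * e - (y' x + ω * y x) * e1

theorem IsSolution.norm_deriv_add_mul_le (hq : IntervalIntegrable q volume 0 1)
    (hy : IsSolution q (z ^ 2) y y') {ω : ℂ} (hω : ω ^ 2 = -z ^ 2) {τ M : ℝ} (hωτ : |ω.re| ≤ τ)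
    (hM : ∀ t ∈ Icc (0 : ℝ) 1, ‖y t‖ ≤ M * Real.exp (τ * t)) {x : ℝ} (hx : x ∈ Icc (0 : ℝ) 1) :
    ‖y' x + ω * y x - Complex.exp (ω * x) * (y' 0 + ω * y 0)‖
      ≤ M * (∫ t in (0 : ℝ)..1, ‖q t‖) * Real.exp (τ * x) := by
  have hM0 : 0 ≤ M := by simpa using (norm_nonneg _).trans (hM 0 (by simp))
  have h0 : (0 : ℝ) ∈ Icc (0 : ℝ) 1 := by simp
  rw [hy.deriv_add_mul_eq hω hx]
  have hb : ‖∫ t in (0 : ℝ)..x, q t * (Complex.exp (ω * (x - t : ℝ)) * y t)‖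
      ≤ ∫ t in (0 : ℝ)..x, ‖q t‖ * (M * Real.exp (τ * x)) := by
    refine intervalIntegral.norm_integral_le_of_norm_le hx.1 (Eventually.of_forall fun t ht => ?_)
      ((intervalIntegrable_of_mem hq.norm h0 hx).mul_const _)
    rw [norm_mul, norm_mul]
    refine mul_le_mul_of_nonneg_left ?_ (norm_nonneg _)
    have h1 := norm_exp_mul_ofReal_le hωτ (s := x - t) (by linarith [ht.2])
    have h2 := hM t ⟨ht.1.le, ht.2.trans hx.2⟩
    calc _ ≤ Real.exp (τ * (x - t)) * (M * Real.exp (τ * t)) := by gcongr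
      _ = M * (Real.exp (τ * (x - t)) * Real.exp (τ * t)) := by ring
      _ = M * Real.exp (τ * x) := by rw [← Real.exp_add]; ring_nf
  refine hb.trans ?_
  rw [intervalIntegral.integral_mul_const]
  have := integral_norm_le hq hx
  calc _ ≤ (∫ t in (0 : ℝ)..1, ‖q t‖) * (M * Real.exp (τ * x)) := by gcongr
    _ = _ := by ring

/-- The estimates for `ω = iz` and `ω = -iz` are combined: half the sum isolates `y'`, and the
difference divided by `2iz` isolates `y`, which gains the factor `1/‖z‖`. -/
theorem IsSolution.norm_sub_free_le (hq : IntervalIntegrable q volume 0 1)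
    (hy : IsSolution q (z ^ 2) y y') (hz : z ≠ 0) {M : ℝ}
    (hM : ∀ t ∈ Icc (0 : ℝ) 1, ‖y t‖ ≤ M * Real.exp (|z.im| * t)) {x : ℝ}
    (hx : x ∈ Icc (0 : ℝ) 1) :
    ‖y x - (y 0 * Complex.cos (z * x) + y' 0 * (Complex.sin (z * x) / z))‖
        ≤ M * (∫ t in (0 : ℝ)..1, ‖q t‖) / ‖z‖ * Real.exp (|z.im| * x) ∧
      ‖y' x - (y' 0 * Complex.cos (z * x) - y 0 * (z * Complex.sin (z * x)))‖
        ≤ M * (∫ t in (0 : ℝ)..1, ‖q t‖) * Real.exp (|z.im| * x) := by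
  have hI := Complex.I_sq
  have h1 := hy.norm_deriv_add_mul_le hq (ω := Complex.I * z) (by rw [mul_pow, hI]; ring)
    (by simp) hM hx
  have h2 := hy.norm_deriv_add_mul_le hq (ω := -(Complex.I * z)) (by rw [neg_sq, mul_pow, hI]; ring)
    (by simp) hM hx
  have hE1 : Complex.exp (Complex.I * z * x)
      = Complex.cos (z * x) + Complex.sin (z * x) * Complex.I := by
    rw [← Complex.exp_mul_I]; ring_nf
  have hE2 : Complex.exp (-(Complex.I * z) * x)
      = Complex.cos (z * x) - Complex.sin (z * x) * Complex.I := by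
    have := Complex.exp_mul_I (-(z * x))
    rw [Complex.cos_neg, Complex.sin_neg] at this
    rw [show -(Complex.I * z) * x = -(z * x) * Complex.I by ring, this]; ring
  set A := y' x + Complex.I * z * y x
    - Complex.exp (Complex.I * z * x) * (y' 0 + Complex.I * z * y 0) with hA
  set B := y' x + -(Complex.I * z) * y x
    - Complex.exp (-(Complex.I * z) * x) * (y' 0 + -(Complex.I * z) * y 0) with hB
  rw [hE1] at hA
  rw [hE2] at hB
  have e1 : y x - (y 0 * Complex.cos (z * x) + y' 0 * (Complex.sin (z * x) / z))
      = (A - B) / (2 * Complex.I * z) := by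
    rw [hA, hB]
    field_simp
    ring
  have e2 : y' x - (y' 0 * Complex.cos (z * x) - y 0 * (z * Complex.sin (z * x)))
      = (A + B) / 2 := by
    rw [hA, hB]
    linear_combination (y 0 * z * Complex.sin (z * x)) * hI
  have hz' : 0 < ‖z‖ := norm_pos_iff.2 hz
  constructor
  · rw [e1, norm_div, norm_mul, norm_mul, Complex.norm_I, Complex.norm_ofNat, mul_one,
      div_le_iff₀ (by positivity)]
    have : M * (∫ t in (0 : ℝ)..1, ‖q t‖) / ‖z‖ * Real.exp (|z.im| * x) * (2 * ‖z‖)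
      = 2 * (M * (∫ t in (0 : ℝ)..1, ‖q t‖) * Real.exp (|z.im| * x)) := by field_simp
    rw [this]
    linarith [norm_sub_le A B]
  · rw [e2, norm_div, Complex.norm_ofNat, div_le_iff₀ (by positivity)]
    linarith [norm_add_le A B]

/-- Absorption argument: let `M` be the maximum of `‖y‖ e^{-|Im z| x}`. The comparison with the free
solution, taken at the maximiser, bounds `M` by the free part plus `M/2`. -/
theorem IsSolution.norm_le (hq : IntervalIntegrable q volume 0 1)
    (hy : IsSolution q (z ^ 2) y y') (hz : z ≠ 0) (hzq : 2 * (∫ t in (0 : ℝ)..1, ‖q t‖) ≤ ‖z‖)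
    {x : ℝ} (hx : x ∈ Icc (0 : ℝ) 1) :
    ‖y x‖ ≤ 2 * (‖y 0‖ + ‖y' 0‖ / ‖z‖) * Real.exp (|z.im| * x) := by
  have hz' : 0 < ‖z‖ := norm_pos_iff.2 hz
  have hc : ContinuousOn (fun t => ‖y t‖ * Real.exp (-(|z.im| * t))) (Icc 0 1) :=
    hy.isPrimitive.continuousOn.norm.mul (by fun_prop)
  obtain ⟨s, hs, hmax⟩ := isCompact_Icc.exists_isMaxOn (nonempty_Icc.2 zero_le_one) hc
  set M := ‖y s‖ * Real.exp (-(|z.im| * s)) with hMdef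
  have hM : ∀ t ∈ Icc (0 : ℝ) 1, ‖y t‖ ≤ M * Real.exp (|z.im| * t) := by
    intro t ht
    have := hmax ht
    rw [mem_ofPred_eq] at this
    calc ‖y t‖ = ‖y t‖ * Real.exp (-(|z.im| * t)) * Real.exp (|z.im| * t) := by
          rw [mul_assoc, ← Real.exp_add]; simp
      _ ≤ _ := by gcongr
  have hM0 : 0 ≤ M := by positivity
  have h1 := (hy.norm_sub_free_le hq hz hM hs).1
  have hcos := norm_cos_le (z * s)
  have hsin := norm_sin_le (z * s)
  rw [abs_im_mul_ofReal z hs.1] at hcos hsin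
  have h2 : ‖y s‖ ≤ (‖y 0‖ + ‖y' 0‖ / ‖z‖ + M * (∫ t in (0 : ℝ)..1, ‖q t‖) / ‖z‖)
      * Real.exp (|z.im| * s) := by
    have h3 : ‖y 0 * Complex.cos (z * s) + y' 0 * (Complex.sin (z * s) / z)‖
        ≤ ‖y 0‖ * Real.exp (|z.im| * s) + ‖y' 0‖ * (Real.exp (|z.im| * s) / ‖z‖) := by
      refine (norm_add_le _ _).trans ?_
      rw [norm_mul, norm_mul, norm_div]
      gcongr
    have h4 := norm_le_norm_add_norm_sub'
      (y s) (y 0 * Complex.cos (z * s) + y' 0 * (Complex.sin (z * s) / z))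
    calc ‖y s‖ ≤ _ := h4
      _ ≤ _ := add_le_add h3 h1
      _ = _ := by ring
  have h5 : M ≤ ‖y 0‖ + ‖y' 0‖ / ‖z‖ + M * (∫ t in (0 : ℝ)..1, ‖q t‖) / ‖z‖ := by
    calc M ≤ (‖y 0‖ + ‖y' 0‖ / ‖z‖ + M * (∫ t in (0 : ℝ)..1, ‖q t‖) / ‖z‖)
      * Real.exp (|z.im| * s) * Real.exp (-(|z.im| * s)) := by rw [hMdef]; gcongr
      _ = _ := by rw [mul_assoc, ← Real.exp_add]; simp
  have h6 : M * (∫ t in (0 : ℝ)..1, ‖q t‖) / ‖z‖ ≤ M / 2 := by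
    rw [div_le_div_iff₀ hz' two_pos]
    nlinarith
  refine (hM x hx).trans ?_
  gcongr
  linarith

/-- Comparison of a solution with the solution of the free equation. -/
theorem IsSolution.norm_sub_free_le_of_large (hq : IntervalIntegrable q volume 0 1)
    (hy : IsSolution q (z ^ 2) y y') (hz : z ≠ 0) (hzq : 2 * (∫ t in (0 : ℝ)..1, ‖q t‖) ≤ ‖z‖)
    {x : ℝ} (hx : x ∈ Icc (0 : ℝ) 1) :
    ‖y x - (y 0 * Complex.cos (z * x) + y' 0 * (Complex.sin (z * x) / z))‖
        ≤ 2 * (‖y 0‖ + ‖y' 0‖ / ‖z‖) * (∫ t in (0 : ℝ)..1, ‖q t‖) / ‖z‖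
          * Real.exp (|z.im| * x) ∧
      ‖y' x - (y' 0 * Complex.cos (z * x) - y 0 * (z * Complex.sin (z * x)))‖
        ≤ 2 * (‖y 0‖ + ‖y' 0‖ / ‖z‖) * (∫ t in (0 : ℝ)..1, ‖q t‖) * Real.exp (|z.im| * x) :=
  hy.norm_sub_free_le hq hz (fun _ ht => hy.norm_le hq hz hzq ht) hx

end Asymptotics

/-! ### The characteristic function -/

section Characteristic

variable {𝕜 : Type*} [RCLike 𝕜]

/-- Reflection carries initial data at `1` to initial data at `0`, so solutions prescribed at the
right endpoint need no separate theory. -/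
theorem IsSolution.reflect {q y y' : ℝ → 𝕜} {l : 𝕜} (hy : IsSolution q l y y') :
    IsSolution (fun x => q (1 - x)) l (fun x => y (1 - x)) (fun x => -y' (1 - x)) where
  isPrimitive := hy.isPrimitive.reflect
  isPrimitive_deriv := by simpa using hy.isPrimitive_deriv.reflect.const_mul (-1)

theorem IsSolution.sub {q y y' u u' : ℝ → 𝕜} {l : 𝕜} (hy : IsSolution q l y y')
    (hu : IsSolution q l u u') :
    IsSolution q l (fun x => y x - u x) (fun x => y' x - u' x) where
  isPrimitive := hy.isPrimitive.sub hu.isPrimitive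
  isPrimitive_deriv := by
    simpa [mul_sub] using hy.isPrimitive_deriv.sub hu.isPrimitive_deriv

theorem IsSolution.const_mul {q y y' : ℝ → 𝕜} {l : 𝕜} (a : 𝕜) (hy : IsSolution q l y y') :
    IsSolution q l (fun x => a * y x) (fun x => a * y' x) where
  isPrimitive := hy.isPrimitive.const_mul a
  isPrimitive_deriv := by
    simpa [mul_left_comm] using hy.isPrimitive_deriv.const_mul a

theorem intervalIntegrable_reflect {q : ℝ → 𝕜} (hq : IntervalIntegrable q volume 0 1) :
    IntervalIntegrable (fun x => q (1 - x)) volume 0 1 := by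
  simpa using (hq.comp_sub_left 1).symm

theorem solution_zero_zero {q : ℝ → 𝕜} (hq : IntervalIntegrable q volume 0 1) (l : 𝕜) :
    solution hq 0 0 l = 0 := by
  have : affine (0 : 𝕜) 0 = 0 := by ext x; simp [affine]
  ext x
  simp [solution, solutionMap, this, IccExtend]

theorem IsSolution.eq_zero {q y y' : ℝ → 𝕜} {l : 𝕜} (hq : IntervalIntegrable q volume 0 1)
    (hy : IsSolution q l y y') (h1 : y 1 = 0) (h1' : y' 1 = 0) {x : ℝ}
    (hx : x ∈ Icc (0 : ℝ) 1) : y x = 0 := by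
  have := hy.reflect.eq_solution (intervalIntegrable_reflect hq) (x := 1 - x)
    ⟨by linarith [hx.2], by linarith [hx.1]⟩
  simpa [h1, h1', solution_zero_zero] using this

/-- Used with `m = l` for constancy of the Wronskian, with `m` the conjugate of `l` for reality of
the eigenvalues, and with `m` variable to differentiate the characteristic function. -/
theorem IsSolution.lagrange {q u u' v v' : ℝ → 𝕜} {l m : 𝕜} (hu : IsSolution q l u u')
    (hv : IsSolution q m v v') {x : ℝ} (hx : x ∈ Icc (0 : ℝ) 1) :
    u x * v' x - u' x * v x
      = u 0 * v' 0 - u' 0 * v 0 + (l - m) * ∫ t in (0 : ℝ)..x, u t * v t := by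
  have h := (hu.isPrimitive.mul hv.isPrimitive_deriv).sub (hu.isPrimitive_deriv.mul hv.isPrimitive)
  have h2 := h.congr (g := fun t => (l - m) * (u t * v t)) (fun _ _ => rfl)
    (Eventually.of_forall fun t _ => by ring)
  rw [h2.eq_add_integral x hx, intervalIntegral.integral_const_mul]

/-- The function `φ'(1,l) + b φ(1,l)`, whose zeros are the eigenvalues. -/
noncomputable def charFun {q : ℝ → 𝕜} (hq : IntervalIntegrable q volume 0 1) (b l : 𝕜) : 𝕜 :=
  solutionDeriv hq 0 1 l 1 + b * solution hq 0 1 l 1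

theorem differentiable_charFun {q : ℝ → 𝕜} (hq : IntervalIntegrable q volume 0 1) (b : 𝕜) :
    Differentiable 𝕜 (charFun hq b) :=
  (differentiable_solutionDeriv hq 0 1 1).add ((differentiable_solution hq 0 1 1).const_mul b)

/-- The solution with `ψ(1) = 1`, `ψ'(1) = -b`. -/
noncomputable def psi {q : ℝ → 𝕜} (hq : IntervalIntegrable q volume 0 1) (b l : 𝕜) : ℝ → 𝕜 :=
  fun x => solution (intervalIntegrable_reflect hq) 1 b l (1 - x)

/-- The derivative of `psi`. -/
noncomputable def psiDeriv {q : ℝ → 𝕜} (hq : IntervalIntegrable q volume 0 1) (b l : 𝕜) :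
    ℝ → 𝕜 :=
  fun x => -solutionDeriv (intervalIntegrable_reflect hq) 1 b l (1 - x)

theorem psi_one {q : ℝ → 𝕜} (hq : IntervalIntegrable q volume 0 1) (b l : 𝕜) :
    psi hq b l 1 = 1 := by simp [psi, solution_zero]

theorem psiDeriv_one {q : ℝ → 𝕜} (hq : IntervalIntegrable q volume 0 1) (b l : 𝕜) :
    psiDeriv hq b l 1 = -b := by simp [psiDeriv, solutionDeriv_zero]

theorem isSolution_psi {q : ℝ → 𝕜} (hq : IntervalIntegrable q volume 0 1) (b l : 𝕜) :
    IsSolution q l (psi hq b l) (psiDeriv hq b l) := by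
  have h := (isSolution_solution (intervalIntegrable_reflect hq) 1 b l).reflect
  simp only [sub_sub_cancel] at h
  exact h

theorem differentiable_psi {q : ℝ → 𝕜} (hq : IntervalIntegrable q volume 0 1) (b : 𝕜) (x : ℝ) :
    Differentiable 𝕜 fun l => psi hq b l x :=
  differentiable_solution _ 1 b (1 - x)

theorem wronskian_solution_psi {q : ℝ → 𝕜} (hq : IntervalIntegrable q volume 0 1) (b l : 𝕜)
    {x : ℝ} (hx : x ∈ Icc (0 : ℝ) 1) :
    solutionDeriv hq 0 1 l x * psi hq b l x - solution hq 0 1 l x * psiDeriv hq b l x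
      = charFun hq b l := by
  have h := fun {x : ℝ} (hx : x ∈ Icc (0 : ℝ) 1) =>
    (isSolution_solution hq 0 1 l).lagrange (isSolution_psi hq b l) hx
  have h1 := h (x := 1) (by simp)
  have h2 := h hx
  simp only [sub_self, zero_mul, add_zero] at h1 h2
  rw [psi_one, psiDeriv_one] at h1
  rw [charFun]
  linear_combination h1 - h2

/-- Both sides have the same value and derivative at `1`, the derivatives agreeing because the
characteristic function vanishes. This is how the norming constants enter. -/
theorem solution_eq_mul_psi {q : ℝ → 𝕜} (hq : IntervalIntegrable q volume 0 1) {b l : 𝕜}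
    (hl : charFun hq b l = 0) {x : ℝ} (hx : x ∈ Icc (0 : ℝ) 1) :
    solution hq 0 1 l x = solution hq 0 1 l 1 * psi hq b l x := by
  refine sub_eq_zero.1 (((isSolution_solution hq 0 1 l).sub
    ((isSolution_psi hq b l).const_mul (solution hq 0 1 l 1))).eq_zero hq ?_ ?_ hx)
  · simp [psi_one]
  · rw [charFun] at hl
    rw [psiDeriv_one]; linear_combination hl

/-- If `φ` vanished identically, its integral equation would force `φ' = 1` and then `φ(1) = 1`. -/
theorem exists_solution_ne_zero {q : ℝ → 𝕜} (hq : IntervalIntegrable q volume 0 1) (l : 𝕜) :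
    ∃ x ∈ Icc (0 : ℝ) 1, solution hq 0 1 l x ≠ 0 := by
  by_contra! h
  have h1 : ∀ x ∈ Icc (0 : ℝ) 1, solutionDeriv hq 0 1 l x = 1 := by
    intro x hx
    rw [solutionDeriv_eq hq 0 1 l hx, intervalIntegral.integral_congr (g := fun _ => 0)]
    · simp
    · intro t ht
      rw [uIcc_of_le hx.1] at ht
      simp [h t ⟨ht.1, ht.2.trans hx.2⟩]
  have h2 := h 1 (by simp)
  rw [solution_eq hq 0 1 l (by simp), intervalIntegral.integral_congr (g := fun _ => 1)] at h2
  · simp at h2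
  · intro t ht
    rw [uIcc_of_le zero_le_one] at ht
    exact h1 t ht

/-- At a zero of the characteristic function, its derivative times `φ(1)` is `-∫ φ²`. -/
theorem solution_mul_deriv_charFun {q : ℝ → 𝕜} (hq : IntervalIntegrable q volume 0 1) {b l : 𝕜}
    (hl : charFun hq b l = 0) :
    solution hq 0 1 l 1 * deriv (charFun hq b) l
      = -∫ t in (0 : ℝ)..1, solution hq 0 1 l t * solution hq 0 1 l t := by
  have hi : IntervalIntegrable (solution hq 0 1 l) volume 0 1 :=
    (continuous_solution hq 0 1 l).intervalIntegrable _ _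
  -- The integral is a bounded linear functional of the solution at `m`, hence differentiable in
  -- `m`.
  set I : 𝕜 → 𝕜 := fun m => volterra hi (solutionMap hq 0 1 m) ⟨1, by simp⟩ with hI
  have hId : Differentiable 𝕜 I :=
    differentiable_eval (F := fun m => volterra hi (solutionMap hq 0 1 m))
      ((volterra hi).differentiable.comp (differentiable_solutionMap hq 0 1)) _
  have hIe : ∀ m, I m = ∫ t in (0 : ℝ)..1, solution hq 0 1 l t * solution hq 0 1 m t :=
    fun m => rfl
  have key : ∀ m, solution hq 0 1 l 1 * charFun hq b m = (l - m) * I m := by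
    intro m
    have h := (isSolution_solution hq 0 1 l).lagrange (isSolution_solution hq 0 1 m)
      (x := 1) (by simp)
    simp only [solution_zero, solutionDeriv_zero] at h
    rw [charFun] at hl ⊢
    rw [hIe]
    linear_combination h + solution hq 0 1 m 1 * hl
  have h1 : HasDerivAt (fun m => solution hq 0 1 l 1 * charFun hq b m)
      (solution hq 0 1 l 1 * deriv (charFun hq b) l) l :=
    ((differentiable_charFun hq b) l).hasDerivAt.const_mul _
  have h2 : HasDerivAt (fun m => (l - m) * I m) (-1 * I l + (l - l) * deriv I l) l :=
    ((hasDerivAt_id l).const_sub l).mul (hId l).hasDerivAt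
  simp_rw [key] at h1
  rw [h1.unique h2, hIe]
  ring

theorem integral_sq_pos {q : ℝ → ℝ} (hq : IntervalIntegrable q volume 0 1) (r : ℝ) :
    0 < ∫ t in (0 : ℝ)..1, solution hq 0 1 r t * solution hq 0 1 r t := by
  obtain ⟨x, hx, hne⟩ := exists_solution_ne_zero hq r
  exact intervalIntegral.integral_pos one_pos
    ((continuous_solution hq 0 1 r).mul (continuous_solution hq 0 1 r)).continuousOn
    (fun t _ => mul_self_nonneg _) ⟨x, hx, mul_self_pos.2 hne⟩

end Characteristic

/-! ### Real potentials -/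

section RealPotential

theorem intervalIntegrable_ofReal {q : ℝ → ℝ} (hq : IntervalIntegrable q volume 0 1) :
    IntervalIntegrable (fun x => (q x : ℂ)) volume 0 1 :=
  ⟨hq.1.ofReal, hq.2.ofReal⟩

variable {q : ℝ → ℝ} (hq : IntervalIntegrable q volume 0 1)

theorem IsPrimitive.ofReal {u f : ℝ → ℝ} (h : IsPrimitive u f) :
    IsPrimitive (fun x => (u x : ℂ)) (fun x => (f x : ℂ)) :=
  ⟨intervalIntegrable_ofReal h.intervalIntegrable, fun x hx => by
    rw [h.eq_add_integral x hx, intervalIntegral.integral_ofReal]; push_cast; rfl⟩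

theorem IsSolution.ofReal {r : ℝ} {y y' : ℝ → ℝ} (h : IsSolution q r y y') :
    IsSolution (fun x => (q x : ℂ)) r (fun x => (y x : ℂ)) (fun x => (y' x : ℂ)) where
  isPrimitive := h.isPrimitive.ofReal
  isPrimitive_deriv := by simpa using h.isPrimitive_deriv.ofReal

theorem solution_ofReal (a c r : ℝ) {x : ℝ} (hx : x ∈ Icc (0 : ℝ) 1) :
    solution (intervalIntegrable_ofReal hq) (a : ℂ) c r x = solution hq a c r x := by
  have := (isSolution_solution hq a c r).ofReal.eq_solution (intervalIntegrable_ofReal hq) hx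
  rw [this, solution_zero, solutionDeriv_zero]

theorem solutionDeriv_ofReal (a c r : ℝ) {x : ℝ} (hx : x ∈ Icc (0 : ℝ) 1) :
    solutionDeriv (intervalIntegrable_ofReal hq) (a : ℂ) c r x = solutionDeriv hq a c r x := by
  have := (isSolution_solution hq a c r).ofReal.eq_solutionDeriv (intervalIntegrable_ofReal hq) hx
  rw [this, solution_zero, solutionDeriv_zero]

theorem charFun_ofReal (b r : ℝ) :
    charFun (intervalIntegrable_ofReal hq) (b : ℂ) r = charFun hq b r := by
  have h1 := solution_ofReal hq 0 1 r (x := 1) (by simp)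
  have h2 := solutionDeriv_ofReal hq 0 1 r (x := 1) (by simp)
  simp only [Complex.ofReal_zero, Complex.ofReal_one] at h1 h2
  simp [charFun, h1, h2]

theorem psi_ofReal (b r : ℝ) {x : ℝ} (hx : x ∈ Icc (0 : ℝ) 1) :
    psi (intervalIntegrable_ofReal hq) (b : ℂ) r x = psi hq b r x := by
  have := solution_ofReal (intervalIntegrable_reflect hq) 1 b r (x := 1 - x)
    ⟨by linarith [hx.2], by linarith [hx.1]⟩
  simpa [psi] using this

theorem IsPrimitive.conj {u f : ℝ → ℂ} (h : IsPrimitive u f) :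
    IsPrimitive (fun x => (starRingEnd ℂ) (u x)) (fun x => (starRingEnd ℂ) (f x)) := by
  refine ⟨?_, fun x hx => ?_⟩
  · have := h.intervalIntegrable
    rw [intervalIntegrable_iff] at this ⊢
    exact Complex.conjCLE.toContinuousLinearMap.integrable_comp this
  · rw [h.eq_add_integral x hx, map_add]
    congr 1
    have h0 : (0 : ℝ) ∈ Icc (0 : ℝ) 1 := by simp
    exact (Complex.conjCLE.toContinuousLinearMap.intervalIntegral_comp_comm
      (intervalIntegrable_of_mem h.intervalIntegrable h0 hx)).symm

theorem IsSolution.conj {l : ℂ} {y y' : ℝ → ℂ} (h : IsSolution (fun x => (q x : ℂ)) l y y') :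
    IsSolution (fun x => (q x : ℂ)) ((starRingEnd ℂ) l) (fun x => (starRingEnd ℂ) (y x))
      (fun x => (starRingEnd ℂ) (y' x)) where
  isPrimitive := h.isPrimitive.conj
  isPrimitive_deriv := by simpa using h.isPrimitive_deriv.conj

/-- The zeros of the characteristic function are real. -/
theorem im_eq_zero_of_charFun_eq_zero {b : ℝ} {l : ℂ}
    (hl : charFun (intervalIntegrable_ofReal hq) (b : ℂ) l = 0) : l.im = 0 := by
  have hs := isSolution_solution (intervalIntegrable_ofReal hq) 0 1 l
  have h := hs.lagrange hs.conj (x := 1) (by simp)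
  simp only [solution_zero, solutionDeriv_zero, Complex.mul_conj] at h
  set φ := solution (intervalIntegrable_ofReal hq) 0 1 l
  set φ' := solutionDeriv (intervalIntegrable_ofReal hq) 0 1 l
  have hc : φ' 1 = -b * φ 1 := by
    rw [charFun] at hl; linear_combination hl
  have hpos : 0 < ∫ t in (0 : ℝ)..1, Complex.normSq (φ t) := by
    obtain ⟨x, hx, hne⟩ := exists_solution_ne_zero (intervalIntegrable_ofReal hq) l
    exact intervalIntegral.integral_pos one_pos
      (Complex.continuous_normSq.comp (continuous_solution _ 0 1 l)).continuousOn
      (fun t _ => Complex.normSq_nonneg _) ⟨x, hx, Complex.normSq_pos.2 hne⟩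
  rw [intervalIntegral.integral_ofReal, hc] at h
  simp only [map_mul, map_neg, Complex.conj_ofReal, map_zero, map_one] at h
  -- The boundary terms at `1` cancel because `b` is real.
  have h3 : (l - (starRingEnd ℂ) l) * ((∫ t in (0 : ℝ)..1, Complex.normSq (φ t) : ℝ) : ℂ) = 0 := by
    linear_combination -h
  rcases mul_eq_zero.1 h3 with h4 | h4
  · exact Complex.conj_eq_iff_im.1 (sub_eq_zero.1 h4).symm
  · exact absurd (Complex.ofReal_eq_zero.1 h4) hpos.ne'

/-- The integral of `φ²` carries no modulus, so its positivity needs `φ` real, which holds at a real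
parameter. -/
theorem deriv_charFun_ofReal_ne_zero {b r : ℝ} (hr : charFun hq b r = 0) :
    deriv (charFun (intervalIntegrable_ofReal hq) (b : ℂ)) r ≠ 0 := by
  intro h0
  have hc : charFun (intervalIntegrable_ofReal hq) (b : ℂ) r = 0 := by
    rw [charFun_ofReal hq, hr]; simp
  have h := solution_mul_deriv_charFun _ hc
  rw [h0, mul_zero, intervalIntegral.integral_congr (g := fun t =>
    ((solution hq 0 1 r t * solution hq 0 1 r t : ℝ) : ℂ)), intervalIntegral.integral_ofReal] at h
  · have := integral_sq_pos hq r
    rw [eq_comm, neg_eq_zero, Complex.ofReal_eq_zero] at h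
    exact this.ne' h
  · intro t ht
    rw [uIcc_of_le zero_le_one] at ht
    have h1 := solution_ofReal hq 0 1 r ht
    simp only [Complex.ofReal_zero, Complex.ofReal_one] at h1
    simp [h1]

theorem solution_mul_deriv_charFun_neg {b r : ℝ} (hr : charFun hq b r = 0) :
    solution hq 0 1 r 1 * deriv (charFun hq b) r < 0 := by
  rw [solution_mul_deriv_charFun hq hr]
  linarith [integral_sq_pos hq r]

end RealPotential

/-! ### Eigenvalues as zeros of the characteristic function -/

section Bridge

theorem ae_unitMeasure_iff {P : ℝ → Prop} :
    (∀ᵐ x ∂unitMeasure, P x) ↔ ∀ᵐ x, x ∈ Ioo (0 : ℝ) 1 → P x :=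
  ae_restrict_iff' measurableSet_Ioo

theorem IsRegular.isSolution {q y : ℝ → ℝ} {r : ℝ} (hy : IsRegular y)
    (he : expression q y =ᵐ[unitMeasure] fun x => r * y x) : IsSolution q r y (D y) where
  isPrimitive := by
    have hc : ContinuousOn (D y) (Icc 0 1) := by
      simpa using hy.absolutelyContinuous.continuousOn
    refine ⟨ContinuousOn.intervalIntegrable_of_Icc zero_le_one hc, fun x hx => ?_⟩
    rw [intervalIntegral.integral_eq_sub_of_hasDerivAt_of_le hx.1
      (hy.differentiableOn.continuousOn.mono (Icc_subset_Icc_right hx.2))]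
    · ring
    · intro t ht
      have ht' : t ∈ Ioo (0 : ℝ) 1 := ⟨ht.1, ht.2.trans_le hx.2⟩
      exact (hy.differentiableOn t (Ioo_subset_Icc_self ht')).hasDerivWithinAt.hasDerivAt
        (Icc_mem_nhds ht'.1 ht'.2)
    · exact ContinuousOn.intervalIntegrable_of_Icc hx.1 (hc.mono (Icc_subset_Icc_right hx.2))
  isPrimitive_deriv := by
    have h1 : IsPrimitive (D y) (deriv (D y)) := by
      refine isPrimitive_of_absolutelyContinuous hy.absolutelyContinuous
        hy.absolutelyContinuous.intervalIntegrable_deriv ?_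
      filter_upwards [hy.absolutelyContinuous.ae_differentiableAt] with x hx hx'
      refine (hx ?_).hasDerivAt
      rw [uIcc_of_le zero_le_one]
      exact Ioo_subset_Icc_self hx'
    refine h1.congr (fun _ _ => rfl) ?_
    filter_upwards [ae_unitMeasure_iff.1 he] with x hx hx'
    have := hx hx'
    rw [expression] at this
    linarith

theorem IsSolution.D_eq {q y y' : ℝ → ℝ} {r : ℝ} (h : IsSolution q r y y') :
    EqOn (D y) y' (Icc 0 1) := fun x hx =>
  (h.isPrimitive.hasDerivWithinAt h.isPrimitive_deriv.continuousOn hx).derivWithin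
    (uniqueDiffOn_Icc one_pos x hx)

theorem IsSolution.isRegular {q y y' : ℝ → ℝ} {r : ℝ} (h : IsSolution q r y y') :
    IsRegular y where
  differentiableOn _ hx := (h.isPrimitive.hasDerivWithinAt
    h.isPrimitive_deriv.continuousOn hx).differentiableWithinAt
  absolutelyContinuous := absolutelyContinuousOnInterval_congr (fun _ hx => (h.D_eq hx).symm)
    h.isPrimitive_deriv.absolutelyContinuous

theorem IsSolution.expression_ae_eq {q y y' : ℝ → ℝ} {r : ℝ} (h : IsSolution q r y y') :
    expression q y =ᵐ[unitMeasure] fun x => r * y x := by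
  have h1 := h.isPrimitive_deriv.congr (fun _ hx => (h.D_eq hx).symm)
    (Eventually.of_forall fun x _ => rfl)
  refine ae_unitMeasure_iff.2 ?_
  filter_upwards [h1.ae_hasDerivAt] with x hx hx'
  rw [expression, (hx hx').deriv]
  ring

variable {q : ℝ → ℝ} (hq : IntervalIntegrable q volume 0 1)

/-- The choice made by `Classical.epsilon` is harmless: a solution exists and is unique on `[0,1]`.
-/
theorem phi_one_eq_solution (r : ℝ) : phi q r 1 = solution hq 0 1 r 1 := by
  have hs := isSolution_solution hq 0 1 r
  have hex : ∃ y, IsPhi q r y := ⟨solution hq 0 1 r, hs.isRegular, hs.expression_ae_eq,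
    solution_zero hq 0 1 r, by rw [hs.D_eq (by simp), solutionDeriv_zero]⟩
  have h : IsPhi q r (phi q r) := Classical.epsilon_spec hex
  have := (h.regular.isSolution h.equation).eq_solution hq (x := 1) (by simp)
  rwa [h.value_zero, h.deriv_zero] at this

theorem memLp_of_continuous {f : ℝ → ℝ} (hf : Continuous f) : MemLp f 2 unitMeasure := by
  obtain ⟨C, hC⟩ := isCompact_Icc.exists_bound_of_continuousOn (s := Icc (0 : ℝ) 1) hf.continuousOn
  refine MemLp.of_bound hf.aestronglyMeasurable C (ae_unitMeasure_iff.2 ?_)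
  exact Eventually.of_forall fun x hx => hC x (Ioo_subset_Icc_self hx)

/-- The condition at `0` makes an eigenfunction equal to `y'(0) φ` with `y'(0) ≠ 0`; the condition
at `1` then says that the characteristic function vanishes. -/
theorem isEigenvalue_iff (b r : ℝ) : IsEigenvalue q b r ↔ charFun hq b r = 0 := by
  constructor
  · rintro ⟨y, hy, hne, he⟩
    have hs := hy.regular.isSolution he
    have hs2 := (isSolution_solution hq 0 1 r).const_mul (D y 0)
    have e : ∀ x ∈ Icc (0 : ℝ) 1, y x = D y 0 * solution hq 0 1 r x := by
      intro x hx
      have h1 := hs.eq_solution hq hx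
      have h2 := hs2.eq_solution hq hx
      rw [h1, h2, hy.left_bc, solution_zero, solutionDeriv_zero, mul_zero, mul_one]
    have e' : ∀ x ∈ Icc (0 : ℝ) 1, D y x = D y 0 * solutionDeriv hq 0 1 r x := by
      intro x hx
      have h1 := hs.eq_solutionDeriv hq hx
      have h2 := hs2.eq_solutionDeriv hq hx
      rw [h1, h2, hy.left_bc, solution_zero, solutionDeriv_zero, mul_zero, mul_one]
    have h0 : D y 0 ≠ 0 := by
      intro h0
      refine hne (ae_unitMeasure_iff.2 (Eventually.of_forall fun x hx => ?_))
      rw [e x (Ioo_subset_Icc_self hx), h0]; simp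
    have hb := hy.right_bc
    rw [e 1 (by simp), e' 1 (by simp)] at hb
    refine (mul_eq_zero.1 (?_ : D y 0 * charFun hq b r = 0)).resolve_left h0
    rw [charFun]; linear_combination hb
  · intro h
    have hs := isSolution_solution hq 0 1 r
    refine ⟨solution hq 0 1 r, ⟨hs.isRegular, ?_, solution_zero hq 0 1 r, ?_⟩, ?_,
      hs.expression_ae_eq⟩
    · exact (memLp_congr_ae hs.expression_ae_eq).2
        (memLp_of_continuous ((continuous_solution hq 0 1 r).const_mul r))
    · rw [hs.D_eq (by simp)]; exact h
    · intro h0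
      have hpos := integral_sq_pos hq r
      rw [intervalIntegral.integral_congr_ae (g := fun _ => 0)] at hpos
      · simp at hpos
      · filter_upwards [ae_unitMeasure_iff.1 h0, ae_mem_Ioo_of_mem_uIcc] with x hx hx2 hx3
        simp [hx (hx2 (uIoc_subset_uIcc hx3))]

/-! ### Location of the eigenvalues -/

theorem norm_charFun_sub_cos_le {q : ℝ → ℂ} (hq : IntervalIntegrable q volume 0 1) (b : ℂ) {z : ℂ}
    (hz : z ≠ 0) (hzq : 2 * (∫ t in (0 : ℝ)..1, ‖q t‖) ≤ ‖z‖) :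
    ‖charFun hq b (z ^ 2) - Complex.cos z‖
      ≤ 2 * ((∫ t in (0 : ℝ)..1, ‖q t‖) + ‖b‖) / ‖z‖ * Real.exp |z.im| := by
  have hs := isSolution_solution hq 0 1 (z ^ 2)
  have h1 := hs.norm_le hq hz hzq (x := 1) (by simp)
  have h2 := (hs.norm_sub_free_le_of_large hq hz hzq (x := 1) (by simp)).2
  simp only [solution_zero, solutionDeriv_zero, norm_zero, norm_one, Complex.ofReal_one, mul_one,
    one_mul, zero_mul, sub_zero, zero_add] at h1 h2
  have e : charFun hq b (z ^ 2) - Complex.cos z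
      = (solutionDeriv hq 0 1 (z ^ 2) 1 - Complex.cos z) + b * solution hq 0 1 (z ^ 2) 1 := by
    rw [charFun]; ring
  rw [e]
  refine (norm_add_le _ _).trans ?_
  rw [norm_mul]
  calc _ ≤ 2 * (1 / ‖z‖) * (∫ t in (0 : ℝ)..1, ‖q t‖) * Real.exp |z.im|
        + ‖b‖ * (2 * (1 / ‖z‖) * Real.exp |z.im|) := by gcongr
    _ = _ := by ring

/-- At `z = iτ` the parameter is `-τ²` and `cos z = cosh τ ≥ e^τ/2`, which exceeds the error term
once `τ` is large. -/
theorem exists_charFun_pos (b : ℝ) : ∃ T : ℝ, ∀ r ≤ T, 0 < charFun hq b r := by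
  have hqc := intervalIntegrable_ofReal hq
  set N := ∫ t in (0 : ℝ)..1, ‖(q t : ℂ)‖ with hN
  have hN0 : 0 ≤ N := intervalIntegral.integral_nonneg zero_le_one fun _ _ => norm_nonneg _
  -- Chosen so that `τ ≥ R` makes the relative error `2 (N + |b|)/τ` less than `1/2`.
  set R := 4 * (N + |b|) + 1 with hR
  have hR0 : 0 < R := by positivity
  refine ⟨-R ^ 2, fun r hr => ?_⟩
  set τ := √(-r) with hτ
  have hτ2 : τ ^ 2 = -r := Real.sq_sqrt (by nlinarith)
  have hRτ : R ≤ τ := Real.le_sqrt_of_sq_le (by linarith)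
  have hτ0 : 0 < τ := by linarith
  have hnorm : ‖(τ * Complex.I : ℂ)‖ = τ := by simp [abs_of_pos hτ0]
  have h := norm_charFun_sub_cos_le hqc (b : ℂ) (z := τ * Complex.I)
    (by simp [hτ0.ne']) (by rw [hnorm]; linarith [abs_nonneg b])
  have hz2 : (τ * Complex.I : ℂ) ^ 2 = (r : ℂ) := by
    rw [mul_pow, Complex.I_sq]
    have : ((τ ^ 2 : ℝ) : ℂ) = ((-r : ℝ) : ℂ) := by rw [hτ2]
    push_cast at this
    rw [this]; ring
  rw [hz2, charFun_ofReal hq, Complex.cos_mul_I, ← Complex.ofReal_cosh, ← Complex.ofReal_sub,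
    Complex.norm_real, hnorm, Real.norm_eq_abs, Complex.norm_real, Real.norm_eq_abs, ← hN] at h
  have him : |(τ * Complex.I : ℂ).im| = τ := by simp [abs_of_pos hτ0]
  rw [him] at h
  have h1 : 2 * (N + |b|) / τ * Real.exp τ < Real.exp τ / 2 := by
    have : 2 * (N + |b|) / τ < 1 / 2 := by
      rw [div_lt_div_iff₀ hτ0 two_pos]; linarith
    nlinarith [Real.exp_pos τ]
  have h2 : Real.exp τ / 2 ≤ Real.cosh τ := by
    rw [Real.cosh_eq]; linarith [Real.exp_pos (-τ)]
  linarith [(abs_le.1 h).1]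

/-- At `z = kπ` the cosine is `(-1)^k` and the error is less than `1`. The alternating signs produce
infinitely many zeros. -/
theorem charFun_sq_pi_mul {b : ℝ} {k : ℕ} (hk : 2 * ((∫ t in (0 : ℝ)..1, ‖(q t : ℂ)‖) + |b|) < k) :
    0 < (-1) ^ k * charFun hq b ((k * Real.pi) ^ 2) := by
  have hN0 : 0 ≤ ∫ t in (0 : ℝ)..1, ‖(q t : ℂ)‖ :=
    intervalIntegral.integral_nonneg zero_le_one fun _ _ => norm_nonneg _
  set N := ∫ t in (0 : ℝ)..1, ‖(q t : ℂ)‖ with hN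
  have hk0 : (0 : ℝ) < k := by linarith [abs_nonneg b]
  have hkπ : (k : ℝ) ≤ k * Real.pi := by nlinarith [Real.pi_gt_three]
  have hpos : 0 < k * Real.pi := by positivity
  have hnorm : ‖((k * Real.pi : ℝ) : ℂ)‖ = k * Real.pi := by
    rw [Complex.norm_real, Real.norm_eq_abs, abs_of_pos hpos]
  have h := norm_charFun_sub_cos_le (intervalIntegrable_ofReal hq) (b : ℂ)
    (z := ((k * Real.pi : ℝ) : ℂ)) (by exact_mod_cast hpos.ne')
    (by rw [hnorm]; linarith [abs_nonneg b])
  rw [← Complex.ofReal_pow, charFun_ofReal hq, ← Complex.ofReal_cos, ← Complex.ofReal_sub,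
    Complex.norm_real, Complex.norm_real, Complex.norm_real, Real.cos_nat_mul_pi,
    Complex.ofReal_im, abs_zero, Real.exp_zero, mul_one, ← hN] at h
  simp only [Real.norm_eq_abs, abs_of_pos hpos] at h
  have h1 : 2 * (N + |b|) / (k * Real.pi) < 1 := by
    rw [div_lt_one hpos]; linarith
  have h2 := abs_lt.1 (h.trans_lt h1)
  rcases neg_one_pow_eq_or ℝ k with e | e <;> rw [e] at h2 ⊢ <;> linarith [h2.1, h2.2]

theorem infinite_zeros_charFun (b : ℝ) : {r | charFun hq b r = 0}.Infinite := by
  refine infinite_of_not_bddAbove fun ⟨R, hR⟩ => ?_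
  set N := ∫ t in (0 : ℝ)..1, ‖(q t : ℂ)‖ with hN
  obtain ⟨k, hk⟩ := exists_nat_gt (max (2 * (N + |b|)) |R|)
  have hk1 : 2 * (N + |b|) < k := (le_max_left _ _).trans_lt hk
  have hk2 : |R| < k := (le_max_right _ _).trans_lt hk
  have hk0 : (0 : ℝ) < k := (abs_nonneg R).trans_lt hk2
  have hk3 : (1 : ℝ) ≤ k := by exact_mod_cast (by exact_mod_cast hk0 : 0 < k)
  have h1 := charFun_sq_pi_mul hq hk1
  have h2 := charFun_sq_pi_mul hq (b := b) (k := k + 1) (by push_cast; linarith)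
  have hle : (k * Real.pi) ^ 2 ≤ ((k + 1 : ℕ) * Real.pi) ^ 2 := by
    push_cast; gcongr; linarith
  have hc : ContinuousOn (fun r => (-1) ^ k * charFun hq b r)
      (Icc ((k * Real.pi) ^ 2) (((k + 1 : ℕ) * Real.pi) ^ 2)) :=
    ((differentiable_charFun hq b).continuous.const_mul _).continuousOn
  have h0 : (-1) ^ k * charFun hq b (((k + 1 : ℕ) * Real.pi) ^ 2) ≤ 0 := by
    rw [pow_succ] at h2; linarith
  obtain ⟨r, hr, hr0⟩ := intermediate_value_Icc' hle hc ⟨h0, h1.le⟩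
  have hr1 : charFun hq b r = 0 := (mul_eq_zero.1 hr0).resolve_left (by simp)
  have h3 := hR hr1
  have h4 : (k : ℝ) ≤ (k * Real.pi) ^ 2 := by
    have : (k : ℝ) ≤ k * Real.pi := by nlinarith [Real.pi_gt_three]
    nlinarith
  linarith [hr.1, le_abs_self R]

/-- The zeros are bounded below, so infinitely many of them would accumulate; the limit would be a
zero with nonzero derivative, which is isolated. -/
theorem finite_zeros_charFun_Iic (b t : ℝ) : ({r | charFun hq b r = 0} ∩ Iic t).Finite := by
  obtain ⟨T, hT⟩ := exists_charFun_pos hq b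
  by_contra hinf
  have hsub : {r | charFun hq b r = 0} ∩ Iic t ⊆ Icc T t := fun r hr =>
    ⟨le_of_not_gt fun h => (hT r h.le).ne' hr.1, hr.2⟩
  obtain ⟨c, -, hacc⟩ := Set.Infinite.exists_accPt_of_subset_isCompact hinf isCompact_Icc hsub
  have hfreq : ∃ᶠ r in 𝓝[≠] c, charFun hq b r = 0 :=
    (accPt_iff_frequently_nhdsNE.1 hacc).mono fun r hr => hr.1
  have hd := differentiable_charFun hq b
  have hc : charFun hq b c = 0 := by
    by_contra hne
    have := (hd.continuous.continuousAt.eventually_ne hne).filter_mono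
      (nhdsWithin_le_nhds (s := {c}ᶜ))
    exact hfreq (this.mono fun _ h => h)
  have hne : deriv (charFun hq b) c ≠ 0 := fun h0 => by
    have := solution_mul_deriv_charFun_neg hq hc
    rw [h0, mul_zero] at this
    exact lt_irrefl _ this
  exact hfreq (((hd c).hasDerivAt.eventually_ne hne).mono fun _ h => h)

end Bridge

/-! ### Enumeration -/

theorem range_sInf_encard_eq {Z : Set ℝ} (hinf : Z.Infinite) (hfin : ∀ t, (Z ∩ Iic t).Finite) :
    range (fun n : ℕ => sInf {t : ℝ | (n + 1 : ℕ∞) ≤ (Z ∩ Iic t).encard}) = Z := by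
  apply Subset.antisymm
  · rintro _ ⟨n, rfl⟩
    set S := {t : ℝ | (n + 1 : ℕ∞) ≤ (Z ∩ Iic t).encard} with hS
    -- Any `t` in `S` can be lowered to the largest element of `Z` below it, so the infimum is
    -- attained in `Z`.
    have hmax : ∀ t ∈ S, ∃ m ∈ Z, m ≤ t ∧ m ∈ S := by
      intro t ht
      have hne : (Z ∩ Iic t).Nonempty := by
        rw [← encard_pos]; exact lt_of_lt_of_le (by simp) ht
      obtain ⟨m, hm, hmmax⟩ := (hfin t).exists_maximal hne
      refine ⟨m, hm.1, hm.2, ?_⟩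
      have : Z ∩ Iic t ⊆ Z ∩ Iic m := fun r hr => ⟨hr.1, by
        rcases le_total r m with h | h
        · exact h
        · exact hmmax hr h⟩
      exact le_trans ht (encard_le_encard this)
    -- Infinitude of `Z` makes `S` nonempty; otherwise `sInf` would take its default value `0`.
    obtain ⟨F, hFZ, hFfin, hF⟩ := hinf.exists_subset_ncard_eq (n + 1)
    have hSne : S.Nonempty := by
      obtain ⟨t, ht⟩ := hFfin.bddAbove
      refine ⟨t, ?_⟩
      have : F ⊆ Z ∩ Iic t := fun r hr => ⟨hFZ hr, ht hr⟩
      refine le_trans ?_ (encard_le_encard this)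
      rw [← hFfin.cast_ncard_eq, hF]; simp
    obtain ⟨t, ht⟩ := hSne
    obtain ⟨m₀, hm₀Z, hm₀t, hm₀S⟩ := hmax t ht
    obtain ⟨m, hm, hmin⟩ := ((hfin t).inter_of_left S).exists_minimal
      ⟨m₀, ⟨hm₀Z, hm₀t⟩, hm₀S⟩
    have hleast : IsLeast S m := by
      refine ⟨hm.2, fun s hs => ?_⟩
      obtain ⟨m', hm'Z, hm's, hm'S⟩ := hmax s hs
      by_contra! hlt
      have := hmin ⟨⟨hm'Z, (hm's.trans hlt.le).trans hm.1.2⟩, hm'S⟩ (hm's.trans hlt.le)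
      linarith
    show sInf S ∈ Z
    rw [hleast.csInf_eq]
    exact hm.1.1
  · intro r hr
    have hf : (Z ∩ Iio r).Finite := (hfin r).subset (inter_subset_inter_right _ Iio_subset_Iic_self)
    -- The index of `r` is the number of elements of `Z` strictly below it, as counting starts at
    -- `0`.
    refine ⟨(Z ∩ Iio r).ncard, ?_⟩
    have hc : ((Z ∩ Iio r).ncard : ℕ∞) = (Z ∩ Iio r).encard := hf.cast_ncard_eq
    have hins : Z ∩ Iic r = insert r (Z ∩ Iio r) := by
      ext s
      simp only [mem_inter_iff, mem_Iic, mem_insert_iff, mem_Iio, le_iff_lt_or_eq]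
      constructor
      · rintro ⟨h1, h2 | h2⟩
        · exact Or.inr ⟨h1, h2⟩
        · exact Or.inl h2
      · rintro (h | ⟨h1, h2⟩)
        · exact ⟨h ▸ hr, Or.inr h⟩
        · exact ⟨h1, Or.inl h2⟩
    have hcard : (Z ∩ Iic r).encard = (Z ∩ Iio r).encard + 1 := by
      rw [hins, encard_insert_of_notMem (by simp)]
    have hleast : IsLeast {t : ℝ | ((Z ∩ Iio r).ncard + 1 : ℕ∞) ≤ (Z ∩ Iic t).encard} r := by
      refine ⟨?_, fun t ht => ?_⟩
      · rw [mem_ofPred_eq, hc, hcard]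
      · by_contra! hlt
        rw [mem_ofPred_eq, hc] at ht
        have h1 : (Z ∩ Iic t).encard ≤ (Z ∩ Iio r).encard :=
          encard_le_encard (inter_subset_inter_right _ fun s hs => lt_of_le_of_lt hs hlt)
        have h2 := ht.trans h1
        rw [← hc] at h2
        exact absurd h2 (by exact_mod_cast Nat.not_succ_le_self _)
    exact hleast.csInf_eq

theorem range_eigenvalue {q : ℝ → ℝ} (hq : IntervalIntegrable q volume 0 1) (b : ℝ) :
    range (eigenvalue q b) = {r | charFun hq b r = 0} := by
  rw [← range_sInf_encard_eq (infinite_zeros_charFun hq b) (finite_zeros_charFun_Iic hq b)]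
  congr 1
  ext n
  have : ∀ t, {r : ℝ | IsEigenvalue q b r ∧ r ≤ t} = {r | charFun hq b r = 0} ∩ Iic t := by
    intro t
    ext r
    simp [isEigenvalue_iff hq]
  simp_rw [eigenvalue, this]

/-! ### Quotients by functions with simple zeros -/

section Quotient

variable {𝕜 : Type*} [RCLike 𝕜]

open Classical in
/-- The quotient `g / w`, continued to the simple zeros of `w`. -/
noncomputable def simpleQuotient (g w : 𝕜 → 𝕜) (c : 𝕜) : 𝕜 :=
  if w c = 0 then deriv g c / deriv w c else g c / w c

theorem simpleQuotient_mul {g w : 𝕜 → 𝕜} (hz : ∀ c, w c = 0 → g c = 0) (c : 𝕜) :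
    simpleQuotient g w c * w c = g c := by
  by_cases h : w c = 0
  · rw [h, mul_zero, hz c h]
  · rw [simpleQuotient, if_neg h, div_mul_cancel₀ _ h]

theorem simpleQuotient_eventuallyEq_div {g w : 𝕜 → 𝕜} (hw : Differentiable 𝕜 w) {c : 𝕜}
    (hc : w c ≠ 0) : simpleQuotient g w =ᶠ[𝓝 c] fun m => g m / w m := by
  filter_upwards [hw.continuous.continuousAt.eventually_ne hc] with m hm
  rw [simpleQuotient, if_neg hm]

/-- Cancelling the common factor `m - c` leaves a quotient of difference quotients whose denominator
is nonzero near `c`. -/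
theorem simpleQuotient_eventuallyEq_dslope {g w : 𝕜 → 𝕜} (hw : Differentiable 𝕜 w) {c : 𝕜}
    (hc : w c = 0) (hgc : g c = 0) (hd : deriv w c ≠ 0) :
    simpleQuotient g w =ᶠ[𝓝 c] fun m => dslope g c m / dslope w c m := by
  have hcont : ContinuousAt (dslope w c) c := continuousAt_dslope_same.2 (hw c)
  filter_upwards [hcont.eventually_ne (by rwa [dslope_same])] with m hm
  by_cases hmc : m = c
  · rw [hmc, simpleQuotient, if_pos hc, dslope_same, dslope_same]
  · have hne : m - c ≠ 0 := sub_ne_zero.2 hmc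
    have hwm : w m = (m - c) * dslope w c m := by
      have := sub_smul_dslope w c m
      rw [hc, sub_zero, smul_eq_mul] at this
      exact this.symm
    have hgm : g m = (m - c) * dslope g c m := by
      have := sub_smul_dslope g c m
      rw [hgc, sub_zero, smul_eq_mul] at this
      exact this.symm
    rw [simpleQuotient, if_neg (by rw [hwm]; exact mul_ne_zero hne hm), hwm, hgm,
      mul_div_mul_left _ _ hne]

theorem continuous_simpleQuotient {g w : 𝕜 → 𝕜} (hg : Differentiable 𝕜 g)
    (hw : Differentiable 𝕜 w) (hz : ∀ c, w c = 0 → g c = 0) (hd : ∀ c, w c = 0 → deriv w c ≠ 0) :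
    Continuous (simpleQuotient g w) := by
  rw [continuous_iff_continuousAt]
  intro c
  by_cases hc : w c = 0
  · refine ContinuousAt.congr ?_ (simpleQuotient_eventuallyEq_dslope hw hc (hz c hc) (hd c hc)).symm
    exact (continuousAt_dslope_same.2 (hg c)).div (continuousAt_dslope_same.2 (hw c))
      (by rw [dslope_same]; exact hd c hc)
  · refine ContinuousAt.congr ?_ (simpleQuotient_eventuallyEq_div hw hc).symm
    exact hg.continuous.continuousAt.div hw.continuous.continuousAt hc

theorem differentiable_simpleQuotient {g w : ℂ → ℂ} (hg : Differentiable ℂ g)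
    (hw : Differentiable ℂ w) (hz : ∀ c, w c = 0 → g c = 0) (hd : ∀ c, w c = 0 → deriv w c ≠ 0) :
    Differentiable ℂ (simpleQuotient g w) := by
  intro c
  by_cases hc : w c = 0
  · refine DifferentiableAt.congr_of_eventuallyEq ?_
      (simpleQuotient_eventuallyEq_dslope hw hc (hz c hc) (hd c hc))
    have h : ∀ {f : ℂ → ℂ}, Differentiable ℂ f → DifferentiableAt ℂ (dslope f c) c := fun hf =>
      ((Complex.differentiableOn_dslope univ_mem).2 hf.differentiableOn).differentiableAt univ_mem
    exact (h hg).div (h hw) (by rw [dslope_same]; exact hd c hc)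
  · exact DifferentiableAt.congr_of_eventuallyEq ((hg c).div (hw c) hc)
      (simpleQuotient_eventuallyEq_div hw hc)

/-- Two real functions with the same zeros, all simple, and with the same sign at one point have
derivatives of the same sign at their zeros. -/
theorem deriv_mul_deriv_pos {g w : ℝ → ℝ} (hg : Differentiable ℝ g) (hw : Differentiable ℝ w)
    (hz : ∀ c, w c = 0 ↔ g c = 0) (hdw : ∀ c, w c = 0 → deriv w c ≠ 0)
    (hdg : ∀ c, g c = 0 → deriv g c ≠ 0) {a : ℝ} (hga : 0 < g a) (hwa : 0 < w a) {r : ℝ}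
    (hr : w r = 0) : 0 < deriv g r * deriv w r := by
  have hF := continuous_simpleQuotient hg hw (fun c hc => (hz c).1 hc) hdw
  -- A continuous quotient without zeros keeps its sign on the line, and it is positive at `a`.
  have hne : ∀ c, simpleQuotient g w c ≠ 0 := by
    intro c
    by_cases hc : w c = 0
    · rw [simpleQuotient, if_pos hc]
      exact div_ne_zero (hdg c ((hz c).1 hc)) (hdw c hc)
    · rw [simpleQuotient, if_neg hc]
      exact div_ne_zero (fun h => hc ((hz c).2 h)) hc
  have hpos : 0 < simpleQuotient g w r := by
    by_contra! hle
    have ha : 0 < simpleQuotient g w a := by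
      rw [simpleQuotient, if_neg hwa.ne']; exact div_pos hga hwa
    obtain ⟨c, hc⟩ := mem_range_of_exists_le_of_exists_ge hF ⟨r, hle⟩ ⟨a, ha.le⟩
    exact hne c hc
  rw [simpleQuotient, if_pos hr] at hpos
  have := mul_pos hpos (mul_self_pos.2 (hdw r hr))
  have e : deriv g r / deriv w r * (deriv w r * deriv w r) = deriv g r * deriv w r := by
    have := hdw r hr
    field_simp
  rwa [e] at this

end Quotient

/-! ### A vanishing criterion -/

section Vanishing

theorem norm_cos_sq (z : ℂ) : ‖Complex.cos z‖ ^ 2 = Real.sinh z.im ^ 2 + Real.cos z.re ^ 2 := by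
  have hc : Complex.cos z = ((Real.cos z.re * Real.cosh z.im : ℝ) : ℂ)
      + ((-(Real.sin z.re * Real.sinh z.im) : ℝ) : ℂ) * Complex.I := by
    rw [Complex.cos_eq z]; push_cast; ring
  rw [hc, Complex.sq_norm, Complex.normSq_add_mul_I]
  have h1 := Real.cosh_sq z.im
  have h2 := Real.sin_sq_add_cos_sq z.re
  linear_combination (Real.cos z.re ^ 2) * h1 + (Real.sinh z.im ^ 2) * h2

/-- The two alternatives are the sides of the squares used below: on vertical ones `‖cos z‖ = cosh
(Im z)`, on horizontal ones `sinh |Im z|` already suffices. -/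
theorem exp_abs_le_norm_cos {z : ℂ} (h : Real.cos z.re ^ 2 = 1 ∨ 1 ≤ |z.im|) :
    Real.exp |z.im| / 4 ≤ ‖Complex.cos z‖ := by
  refine le_of_sq_le_sq ?_ (norm_nonneg _)
  rw [norm_cos_sq]
  have hs : Real.sinh z.im ^ 2 = Real.sinh |z.im| ^ 2 := by
    rcases abs_choice z.im with e | e <;> rw [e]
    rw [Real.sinh_neg, neg_sq]
  rw [hs]
  set t := |z.im|
  have ht : 0 ≤ t := abs_nonneg _
  have he : Real.exp t * Real.exp (-t) = 1 := by rw [← Real.exp_add]; simp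
  have hp := Real.exp_pos t
  have hm := Real.exp_pos (-t)
  rcases h with h | h
  · rw [h]
    have hc := Real.cosh_sq t
    have h2 : Real.exp t / 4 ≤ Real.cosh t := by rw [Real.cosh_eq]; linarith
    rw [← hc]
    gcongr
  · have h1 : 2 ≤ Real.exp t := by linarith [Real.add_one_le_exp t]
    have h2 : Real.exp t / 4 ≤ Real.sinh t := by
      rw [Real.sinh_eq]
      have : Real.exp (-t) ≤ 1 / 2 := by nlinarith
      linarith
    have : (Real.exp t / 4) ^ 2 ≤ Real.sinh t ^ 2 := by gcongr
    nlinarith [sq_nonneg (Real.cos z.re)]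

theorem abs_eq_of_mem_frontier_square {a : ℝ} (ha : 0 < a) {z : ℂ}
    (hz : z ∈ frontier (Ioo (-a) a ×ℂ Ioo (-a) a)) : |z.re| = a ∨ |z.im| = a := by
  have hI : -a < a := by linarith
  rw [Complex.frontier_reProdIm, closure_Ioo hI.ne, frontier_Ioo hI] at hz
  have habs : ∀ t : ℝ, t ∈ ({-a, a} : Set ℝ) → |t| = a := by
    rintro t (rfl | rfl)
    · rw [abs_neg, abs_of_pos ha]
    · exact abs_of_pos ha
  rcases hz with hz | hz
  · exact Or.inr (habs _ hz.2)
  · exact Or.inl (habs _ hz.1)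

/-- If `w(z²)` is asymptotic to `cos z`, `w` has only simple zeros, `G` vanishes at these and
`G(z²) = O(e^{|Im z|}/|z|)`, then `G = 0`. -/
theorem eq_zero_of_vanishing_at_zeros {G w : ℂ → ℂ} (hG : Differentiable ℂ G)
    (hw : Differentiable ℂ w) (hz : ∀ c, w c = 0 → G c = 0) (hd : ∀ c, w c = 0 → deriv w c ≠ 0)
    {C R : ℝ} (hGb : ∀ z : ℂ, R ≤ ‖z‖ → ‖G (z ^ 2)‖ ≤ C / ‖z‖ * Real.exp |z.im|)
    (hwb : ∀ z : ℂ, R ≤ ‖z‖ → ‖w (z ^ 2) - Complex.cos z‖ ≤ C / ‖z‖ * Real.exp |z.im|) (l : ℂ) :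
    G l = 0 := by
  set F := simpleQuotient G w with hF
  have hFd : Differentiable ℂ F := differentiable_simpleQuotient hG hw hz hd
  have hFw := simpleQuotient_mul hz
  obtain ⟨z₀, hz₀⟩ := IsAlgClosed.exists_pow_nat_eq l two_pos
  have hbound : ∀ᶠ k : ℕ in atTop, ‖F (z₀ ^ 2)‖ ≤ 8 * C / k := by
    -- The three thresholds put the boundary where the asymptotics hold, put `z₀` inside the square,
    -- and make `C/‖z‖ ≤ 1/8`, half of the constant in the lower bound for the cosine.
    obtain ⟨K, hK⟩ := exists_nat_gt (max (max R ‖z₀‖) (8 * C))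
    filter_upwards [eventually_ge_atTop (max K 1)] with k hk
    have hkK : (K : ℝ) ≤ k := by exact_mod_cast (le_max_left _ _).trans hk
    have hk1 : (1 : ℝ) ≤ k := by exact_mod_cast (le_max_right _ _).trans hk
    have hkR : R < k := ((le_max_left _ _).trans (le_max_left _ _)).trans_lt (hK.trans_le hkK)
    have hkz : ‖z₀‖ < k := ((le_max_right _ _).trans (le_max_left _ _)).trans_lt (hK.trans_le hkK)
    have hkC : 8 * C < k := (le_max_right _ _).trans_lt (hK.trans_le hkK)
    set a := k * Real.pi with ha
    have hka : (k : ℝ) ≤ a := by nlinarith [Real.pi_gt_three]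
    have ha0 : 0 < a := by linarith
    refine Complex.norm_le_of_forall_mem_frontier_norm_le (f := fun z => F (z ^ 2))
      (U := Ioo (-a) a ×ℂ Ioo (-a) a)
      ((Metric.isBounded_Ioo _ _).reProdIm (Metric.isBounded_Ioo _ _))
      (hFd.comp (differentiable_id.pow 2)).diffContOnCl ?_ ?_
    · intro z hzf
      have hsides := abs_eq_of_mem_frontier_square ha0 hzf
      have hza : a ≤ ‖z‖ := by
        rcases hsides with h | h
        · rw [← h]; exact Complex.abs_re_le_norm z
        · rw [← h]; exact Complex.abs_im_le_norm z
      have hz0 : 0 < ‖z‖ := by linarith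
      have hcos : Real.exp |z.im| / 4 ≤ ‖Complex.cos z‖ := by
        refine exp_abs_le_norm_cos ?_
        rcases hsides with h | h
        · left
          rw [← Real.cos_abs, h, ha, Real.cos_nat_mul_pi, ← pow_mul, mul_comm, pow_mul]
          simp
        · right
          rw [h]; linarith
      have hp := Real.exp_pos |z.im|
      have hw1 := hwb z (by linarith)
      have hG1 := hGb z (by linarith)
      have hCz : C / ‖z‖ ≤ 1 / 8 := by
        rw [div_le_div_iff₀ hz0 (by norm_num)]; linarith
      have hwlow : Real.exp |z.im| / 8 ≤ ‖w (z ^ 2)‖ := by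
        have h1 := norm_sub_norm_le (Complex.cos z) (w (z ^ 2))
        rw [norm_sub_rev] at h1
        nlinarith
      have hwpos : 0 < ‖w (z ^ 2)‖ := by linarith
      have hFn : ‖F (z ^ 2)‖ * ‖w (z ^ 2)‖ = ‖G (z ^ 2)‖ := by rw [← norm_mul, hFw]
      have hC0 : 0 ≤ C := by
        have := (norm_nonneg _).trans hG1
        have h2 : 0 ≤ C / ‖z‖ := by
          by_contra! hneg
          nlinarith
        by_contra! hneg
        have := div_neg_of_neg_of_pos hneg hz0
        linarith
      have h3 : ‖F (z ^ 2)‖ ≤ 8 * C / ‖z‖ := by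
        have h4 : ‖F (z ^ 2)‖ * (Real.exp |z.im| / 8) ≤ C / ‖z‖ * Real.exp |z.im| :=
          (mul_le_mul_of_nonneg_left hwlow (norm_nonneg _)).trans (hFn.le.trans hG1)
        have h5 : ‖F (z ^ 2)‖ * Real.exp |z.im| ≤ 8 * C / ‖z‖ * Real.exp |z.im| := by
          have : 8 * C / ‖z‖ * Real.exp |z.im| = 8 * (C / ‖z‖ * Real.exp |z.im|) := by ring
          linarith
        exact le_of_mul_le_mul_right h5 hp
      refine h3.trans ?_
      gcongr
      linarith
    · apply subset_closure
      rw [Complex.mem_reProdIm]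
      have h1 := abs_lt.1 ((Complex.abs_re_le_norm z₀).trans_lt (hkz.trans_le hka))
      have h2 := abs_lt.1 ((Complex.abs_im_le_norm z₀).trans_lt (hkz.trans_le hka))
      exact ⟨h1, h2⟩
  have hlim : Tendsto (fun k : ℕ => 8 * C / (k : ℝ)) atTop (𝓝 0) :=
    tendsto_const_nhds.div_atTop tendsto_natCast_atTop_atTop
  have hF0 : F (z₀ ^ 2) = 0 := norm_le_zero_iff.1 (ge_of_tendsto hlim hbound)
  rw [← hFw l, ← hz₀, ← hF, hF0, zero_mul]

end Vanishing

/-! ### Uniqueness -/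

section Uniqueness

theorem norm_psi_le {q : ℝ → ℂ} (hq : IntervalIntegrable q volume 0 1) (b : ℂ) {z : ℂ}
    (hz : 1 ≤ ‖z‖) (hzq : 2 * (∫ t in (0 : ℝ)..1, ‖q (1 - t)‖) ≤ ‖z‖) {x : ℝ}
    (hx : x ∈ Icc (0 : ℝ) 1) :
    ‖psi hq b (z ^ 2) x‖ ≤ 2 * (1 + ‖b‖) * Real.exp (|z.im| * (1 - x)) := by
  have hz0 : z ≠ 0 := norm_pos_iff.1 (by linarith)
  have h := (isSolution_solution (intervalIntegrable_reflect hq) 1 b (z ^ 2)).norm_le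
    (intervalIntegrable_reflect hq) hz0 hzq (x := 1 - x) ⟨by linarith [hx.2], by linarith [hx.1]⟩
  rw [solution_zero, solutionDeriv_zero, norm_one] at h
  refine h.trans ?_
  gcongr
  exact div_le_self (norm_nonneg _) hz

/-- The growth rates `e^{|Im z| x}` and `e^{|Im z| (1 - x)}` multiply to that of the characteristic
function; the gain `1/‖z‖` comes from `φ(0) = 0`. -/
theorem norm_solution_mul_psi_le {q p : ℝ → ℂ} (hq : IntervalIntegrable q volume 0 1)
    (hp : IntervalIntegrable p volume 0 1) (b : ℂ) {z : ℂ}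
    (hz : 1 ≤ ‖z‖) (hzq : 2 * (∫ t in (0 : ℝ)..1, ‖q t‖) ≤ ‖z‖)
    (hzp : 2 * (∫ t in (0 : ℝ)..1, ‖p (1 - t)‖) ≤ ‖z‖) {x : ℝ} (hx : x ∈ Icc (0 : ℝ) 1) :
    ‖solution hq 0 1 (z ^ 2) x * psi hp b (z ^ 2) x‖
      ≤ 4 * (1 + ‖b‖) / ‖z‖ * Real.exp |z.im| := by
  have hz0 : z ≠ 0 := norm_pos_iff.1 (by linarith)
  have h1 := (isSolution_solution hq 0 1 (z ^ 2)).norm_le hq hz0 hzq hx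
  rw [solution_zero, solutionDeriv_zero, norm_zero, norm_one, zero_add] at h1
  have h2 := norm_psi_le hp b hz hzp hx
  have he : Real.exp |z.im| = Real.exp (|z.im| * x) * Real.exp (|z.im| * (1 - x)) := by
    rw [← Real.exp_add]; ring_nf
  rw [norm_mul, he]
  calc _ ≤ (2 * (1 / ‖z‖) * Real.exp (|z.im| * x))
        * (2 * (1 + ‖b‖) * Real.exp (|z.im| * (1 - x))) := by gcongr
    _ = _ := by ring

variable {q p : ℝ → ℝ} (hq : IntervalIntegrable q volume 0 1)
  (hp : IntervalIntegrable p volume 0 1)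

/-- For `r = -τ²` the solution differs from `cosh (τ x)` by at most `(K/τ) e^{τ x}`, uniformly in
`x`, and `cosh (τ x) ≥ e^{τ x}/2`. -/
theorem exists_solution_pos (b : ℝ) :
    ∃ T : ℝ, ∀ r ≤ T, ∀ x ∈ Icc (0 : ℝ) 1, 0 < solution hq 1 b r x := by
  have hqc := intervalIntegrable_ofReal hq
  set N := ∫ t in (0 : ℝ)..1, ‖(q t : ℂ)‖ with hN
  have hN0 : 0 ≤ N := intervalIntegral.integral_nonneg zero_le_one fun _ _ => norm_nonneg _
  -- The first term pays for the free sine part `b sin(zx)/z`, the second for the deviation from the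
  -- free solution.
  set K := |b| + 2 * (1 + |b|) * N with hK
  have hb0 := abs_nonneg b
  have hK0 : 0 ≤ K := by positivity
  set R := 1 + 2 * K + 2 * N with hR
  refine ⟨-R ^ 2, fun r hr x hx => ?_⟩
  set τ := √(-r) with hτ
  have hτ2 : τ ^ 2 = -r := Real.sq_sqrt (by nlinarith)
  have hRτ : R ≤ τ := Real.le_sqrt_of_sq_le (by linarith)
  have hτ1 : 1 ≤ τ := by linarith
  have hτ0 : 0 < τ := by linarith
  set z : ℂ := τ * Complex.I with hz
  have hnorm : ‖z‖ = τ := by simp [hz, abs_of_pos hτ0]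
  have him : |z.im| = τ := by simp [hz, abs_of_pos hτ0]
  have hz0 : z ≠ 0 := norm_pos_iff.1 (by linarith)
  have hz2 : z ^ 2 = (r : ℂ) := by
    rw [hz, mul_pow, Complex.I_sq]
    have : ((τ ^ 2 : ℝ) : ℂ) = ((-r : ℝ) : ℂ) := by rw [hτ2]
    push_cast at this
    rw [this]; ring
  have hs := isSolution_solution hqc 1 (b : ℂ) (z ^ 2)
  have h := (hs.norm_sub_free_le_of_large hqc hz0 (by rw [hnorm]; linarith) hx).1
  have hsin := norm_sin_le (z * x)
  rw [abs_im_mul_ofReal z hx.1, him] at hsin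
  have hsol := solution_ofReal hq 1 b r hx
  rw [Complex.ofReal_one] at hsol
  rw [solution_zero, solutionDeriv_zero, hz2, hsol, hnorm, him, norm_one,
    Complex.norm_real, Real.norm_eq_abs, ← hN, one_mul] at h
  have hcos : Complex.cos (z * x) = (Real.cosh (τ * x) : ℂ) := by
    rw [hz, show (τ * Complex.I * x : ℂ) = ((τ * x : ℝ) : ℂ) * Complex.I by push_cast; ring,
      Complex.cos_mul_I, Complex.ofReal_cosh]
  have h2 : ‖((solution hq 1 b r x - Real.cosh (τ * x) : ℝ) : ℂ)‖
      ≤ K / τ * Real.exp (τ * x) := by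
    have e : ((solution hq 1 b r x - Real.cosh (τ * x) : ℝ) : ℂ)
        = (solution hq 1 b r x - (Complex.cos (z * x) + b * (Complex.sin (z * x) / z)))
          + b * (Complex.sin (z * x) / z) := by
      rw [hcos]; push_cast; ring
    rw [e]
    refine (norm_add_le _ _).trans ?_
    rw [norm_mul, norm_div, hnorm, Complex.norm_real, Real.norm_eq_abs]
    have hbτ : |b| / τ ≤ |b| := div_le_self hb0 hτ1
    calc _ ≤ 2 * (1 + |b|) * N / τ * Real.exp (τ * x) + |b| * (Real.exp (τ * x) / τ) := by
          refine add_le_add (h.trans ?_) ?_ <;> gcongr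
      _ = _ := by rw [hK]; ring
  rw [Complex.norm_real, Real.norm_eq_abs] at h2
  have h3 : K / τ < 1 / 2 := by
    rw [div_lt_div_iff₀ hτ0 two_pos]; linarith
  have h4 : Real.exp (τ * x) / 2 ≤ Real.cosh (τ * x) := by
    rw [Real.cosh_eq]; linarith [Real.exp_pos (-(τ * x))]
  have h5 : K / τ * Real.exp (τ * x) < Real.exp (τ * x) / 2 := by
    nlinarith [Real.exp_pos (τ * x)]
  linarith [(abs_le.1 h2).1]

theorem exists_psi_pos (b : ℝ) :
    ∃ T : ℝ, ∀ r ≤ T, ∀ x ∈ Icc (0 : ℝ) 1, 0 < psi hq b r x := by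
  obtain ⟨T, hT⟩ := exists_solution_pos (intervalIntegrable_reflect hq) b
  exact ⟨T, fun r hr x hx => hT r hr (1 - x) ⟨by linarith [hx.2], by linarith [hx.1]⟩⟩

theorem solution_one_ne_zero {b r : ℝ} (hr : charFun hq b r = 0) : solution hq 0 1 r 1 ≠ 0 := by
  intro h0
  have := solution_mul_deriv_charFun_neg hq hr
  rw [h0, zero_mul] at this
  exact lt_irrefl _ this

theorem deriv_charFun_ne_zero {b r : ℝ} (hr : charFun hq b r = 0) :
    deriv (charFun hq b) r ≠ 0 := by
  intro h0
  have := solution_mul_deriv_charFun_neg hq hr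
  rw [h0, mul_zero] at this
  exact lt_irrefl _ this

variable {b h : ℝ}

/-- Each of `φ(1)`, `φ~(1)` has the sign opposite to that of the derivative of its own
characteristic function, and these derivatives agree in sign. -/
theorem solution_one_mul_pos (hzero : ∀ r, charFun hq b r = 0 ↔ charFun hp h r = 0) {r : ℝ}
    (hr : charFun hq b r = 0) : 0 < solution hq 0 1 r 1 * solution hp 0 1 r 1 := by
  obtain ⟨T₁, hT₁⟩ := exists_charFun_pos hq b
  obtain ⟨T₂, hT₂⟩ := exists_charFun_pos hp h
  have hpos := deriv_mul_deriv_pos (differentiable_charFun hp h) (differentiable_charFun hq b)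
    hzero (fun _ => deriv_charFun_ne_zero hq) (fun _ => deriv_charFun_ne_zero hp)
    (hT₂ _ (min_le_right T₁ T₂)) (hT₁ _ (min_le_left T₁ T₂)) hr
  have h1 := solution_mul_deriv_charFun_neg hq hr
  have h2 := solution_mul_deriv_charFun_neg hp ((hzero r).1 hr)
  have h3 := mul_pos_of_neg_of_neg h1 h2
  refine pos_of_mul_pos_left (b := deriv (charFun hp h) r * deriv (charFun hq b) r) ?_ hpos.le
  linarith

theorem solution_mul_psi_eq (hzero : ∀ r, charFun hq b r = 0 ↔ charFun hp h r = 0)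
    (hval : ∀ r, charFun hq b r = 0 → solution hq 0 1 r 1 = solution hp 0 1 r 1) (r : ℝ) {x : ℝ}
    (hx : x ∈ Icc (0 : ℝ) 1) :
    solution hq 0 1 r x * psi hp h r x = solution hp 0 1 r x * psi hq b r x := by
  have hqc := intervalIntegrable_ofReal hq
  have hpc := intervalIntegrable_ofReal hp
  have hreal : ∀ c : ℂ, charFun hqc (b : ℂ) c = 0 → ∃ s : ℝ, c = s ∧ charFun hq b s = 0 := by
    intro c hc
    have him := im_eq_zero_of_charFun_eq_zero hq hc
    have hcr : c = (c.re : ℂ) := Complex.ext rfl (by simp [him])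
    refine ⟨c.re, hcr, ?_⟩
    rw [hcr, charFun_ofReal hq] at hc
    exact_mod_cast hc
  have sol_cast : ∀ {q : ℝ → ℝ} (hq : IntervalIntegrable q volume 0 1) (s : ℝ) {y : ℝ},
      y ∈ Icc (0 : ℝ) 1 →
        solution (intervalIntegrable_ofReal hq) 0 1 (s : ℂ) y
          = ((solution hq 0 1 s y : ℝ) : ℂ) := by
    intro q hq s y hy
    have := solution_ofReal hq 0 1 s hy
    rwa [Complex.ofReal_zero, Complex.ofReal_one] at this
  set N₁ := ∫ t in (0 : ℝ)..1, ‖(q t : ℂ)‖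
  set N₂ := ∫ t in (0 : ℝ)..1, ‖(p t : ℂ)‖
  set N₃ := ∫ t in (0 : ℝ)..1, ‖(q (1 - t) : ℂ)‖
  set N₄ := ∫ t in (0 : ℝ)..1, ‖(p (1 - t) : ℂ)‖
  have hN₁ : 0 ≤ N₁ := intervalIntegral.integral_nonneg zero_le_one fun _ _ => norm_nonneg _
  have hN₂ : 0 ≤ N₂ := intervalIntegral.integral_nonneg zero_le_one fun _ _ => norm_nonneg _
  have hN₃ : 0 ≤ N₃ := intervalIntegral.integral_nonneg zero_le_one fun _ _ => norm_nonneg _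
  have hN₄ : 0 ≤ N₄ := intervalIntegral.integral_nonneg zero_le_one fun _ _ => norm_nonneg _
  have key := eq_zero_of_vanishing_at_zeros
    (G := fun l => solution hqc 0 1 l x * psi hpc (h : ℂ) l x
      - solution hpc 0 1 l x * psi hqc (b : ℂ) l x)
    (w := charFun hqc (b : ℂ))
    (((differentiable_solution hqc 0 1 x).mul (differentiable_psi hpc (h : ℂ) x)).sub
      ((differentiable_solution hpc 0 1 x).mul (differentiable_psi hqc (b : ℂ) x)))
    (differentiable_charFun hqc _) ?_ ?_
    -- One constant `C` majorises both error bounds, and `R` exceeds every threshold of the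
    -- asymptotic estimates.
    (C := 4 * (1 + ‖(h : ℂ)‖) + 4 * (1 + ‖(b : ℂ)‖) + 2 * (N₁ + ‖(b : ℂ)‖))
    (R := 1 + 2 * N₁ + 2 * N₂ + 2 * N₃ + 2 * N₄) ?_ ?_ (r : ℂ)
  · simp only [sol_cast hq r hx, sol_cast hp r hx, psi_ofReal hq b r hx,
      psi_ofReal hp h r hx] at key
    have := sub_eq_zero.1 key
    exact_mod_cast this
  -- At a common zero `φ = φ(1) ψ` and `φ~ = φ~(1) ψ~` with `φ(1) = φ~(1)`, so both products equal
  -- `φ(1) ψ ψ~`.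
  · intro c hc
    obtain ⟨s, rfl, hs⟩ := hreal c hc
    have h1 := solution_eq_mul_psi hq hs hx
    have h2 := solution_eq_mul_psi hp ((hzero s).1 hs) hx
    simp only [sol_cast hq s hx, sol_cast hp s hx, psi_ofReal hq b s hx, psi_ofReal hp h s hx]
    rw [h1, h2, hval s hs]
    push_cast; ring
  · intro c hc
    obtain ⟨s, rfl, hs⟩ := hreal c hc
    exact deriv_charFun_ofReal_ne_zero hq hs
  · intro z hz
    have hz1 : 1 ≤ ‖z‖ := by linarith
    have h1 := norm_solution_mul_psi_le hqc hpc (h : ℂ) hz1 (by linarith) (by linarith) hx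
    have h2 := norm_solution_mul_psi_le hpc hqc (b : ℂ) hz1 (by linarith) (by linarith) hx
    refine (norm_sub_le _ _).trans ((add_le_add h1 h2).trans ?_)
    rw [← add_mul, ← add_div]
    have hle : 4 * (1 + ‖(h : ℂ)‖) + 4 * (1 + ‖(b : ℂ)‖)
        ≤ 4 * (1 + ‖(h : ℂ)‖) + 4 * (1 + ‖(b : ℂ)‖) + 2 * (N₁ + ‖(b : ℂ)‖) :=
      le_add_of_nonneg_right (by positivity)
    exact mul_le_mul_of_nonneg_right (div_le_div_of_nonneg_right hle (norm_nonneg z))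
      (Real.exp_nonneg _)
  · intro z hz
    have hz1 : 1 ≤ ‖z‖ := by linarith
    refine (norm_charFun_sub_cos_le hqc (b : ℂ) (norm_pos_iff.1 (by linarith))
      (by linarith)).trans ?_
    gcongr
    linarith [norm_nonneg (b : ℂ), norm_nonneg (h : ℂ)]

theorem IsSolution.hasDerivWithinAt {y y' : ℝ → ℝ} {r : ℝ} (hy : IsSolution q r y y') {x : ℝ}
    (hx : x ∈ Icc (0 : ℝ) 1) : HasDerivWithinAt y (y' x) (Icc 0 1) x :=
  hy.isPrimitive.hasDerivWithinAt hy.isPrimitive_deriv.continuousOn hx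

/-- This is the derivative of `φ/ψ = φ~/ψ~`, where `(φ/ψ)' = w/ψ²`, with denominators cleared
because `ψ` and `ψ~` may vanish. -/
theorem charFun_mul_psi_sq_eq
    (hG : ∀ r, ∀ x ∈ Icc (0 : ℝ) 1,
      solution hq 0 1 r x * psi hp h r x = solution hp 0 1 r x * psi hq b r x)
    (r : ℝ) {x : ℝ} (hx : x ∈ Icc (0 : ℝ) 1) :
    charFun hq b r * psi hp h r x ^ 2 = charFun hp h r * psi hq b r x ^ 2 := by
  have d1 := ((isSolution_solution hq 0 1 r).hasDerivWithinAt hx).mul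
    ((isSolution_psi hp h r).hasDerivWithinAt hx)
  have d2 := ((isSolution_solution hp 0 1 r).hasDerivWithinAt hx).mul
    ((isSolution_psi hq b r).hasDerivWithinAt hx)
  have e := (uniqueDiffOn_Icc one_pos x hx).eq_deriv _ (d1.congr (fun y hy => (hG r y hy).symm)
    (hG r x hx).symm) d2
  have e0 := hG r x hx
  have w1 := wronskian_solution_psi hq b r hx
  have w2 := wronskian_solution_psi hp h r hx
  rw [← w1, ← w2]
  linear_combination psi hp h r x * psi hq b r x * e
    - (psi hq b r x * psiDeriv hp h r x + psi hp h r x * psiDeriv hq b r x) * e0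

/-- A single parameter suffices: where `ψ` has no zero, `q - r = ψ''/ψ`, and `b = -ψ'(1)`. -/
theorem eq_and_ae_eq_of_psi_eq {r : ℝ} (hpos : ∀ x ∈ Icc (0 : ℝ) 1, 0 < psi hq b r x)
    (heq : ∀ x ∈ Icc (0 : ℝ) 1, psi hq b r x = psi hp h r x) :
    b = h ∧ ∀ᵐ x, x ∈ Ioo (0 : ℝ) 1 → q x = p x := by
  have hsq := isSolution_psi hq b r
  have hsp := isSolution_psi hp h r
  have hd : ∀ x ∈ Icc (0 : ℝ) 1, psiDeriv hq b r x = psiDeriv hp h r x := fun x hx =>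
    (uniqueDiffOn_Icc one_pos x hx).eq_deriv _ (hsq.hasDerivWithinAt hx)
      ((hsp.hasDerivWithinAt hx).congr heq (heq x hx))
  refine ⟨?_, ?_⟩
  · have := hd 1 (by simp)
    rwa [psiDeriv_one, psiDeriv_one, neg_inj] at this
  · have h1 := hsq.isPrimitive_deriv.congr (g := fun x => (q x - r) * psi hq b r x) hd
      (Eventually.of_forall fun _ _ => rfl)
    filter_upwards [h1.ae_hasDerivAt, hsp.isPrimitive_deriv.ae_hasDerivAt] with x h2 h3 hx
    have e := (h2 hx).unique (h3 hx)
    have hx' := Ioo_subset_Icc_self hx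
    rw [← heq x hx'] at e
    linarith [mul_right_cancel₀ (hpos x hx').ne' e]

theorem eq_and_ae_eq_of_charFun (hzero : ∀ r, charFun hq b r = 0 ↔ charFun hp h r = 0)
    (hval : ∀ r, charFun hq b r = 0 → |solution hq 0 1 r 1| = |solution hp 0 1 r 1|) :
    b = h ∧ ∀ᵐ x, x ∈ Ioo (0 : ℝ) 1 → q x = p x := by
  have hval' : ∀ r, charFun hq b r = 0 → solution hq 0 1 r 1 = solution hp 0 1 r 1 := by
    intro r hr
    have hpos := solution_one_mul_pos hq hp hzero hr
    rcases abs_eq_abs.1 (hval r hr) with e | e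
    · exact e
    · rw [e] at hpos
      nlinarith [mul_self_nonneg (solution hp 0 1 r 1)]
  have hG := fun r x hx => solution_mul_psi_eq hq hp hzero hval' r (x := x) hx
  obtain ⟨T₁, hT₁⟩ := exists_charFun_pos hq b
  obtain ⟨T₂, hT₂⟩ := exists_psi_pos hq b
  obtain ⟨T₃, hT₃⟩ := exists_psi_pos hp h
  set r := min T₁ (min T₂ T₃)
  have h1 := hT₁ r (min_le_left _ _)
  have h2 := hT₂ r ((min_le_right _ _).trans (min_le_left _ _))
  have h3 := hT₃ r ((min_le_right _ _).trans (min_le_right _ _))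
  -- At `x = 1` both `ψ` and `ψ~` equal `1`.
  have hw : charFun hq b r = charFun hp h r := by
    have := charFun_mul_psi_sq_eq hq hp hG r (x := 1) (by simp)
    simpa [psi_one] using this
  refine eq_and_ae_eq_of_psi_eq hq hp (r := r) h2 fun x hx => ?_
  have e := charFun_mul_psi_sq_eq hq hp hG r hx
  rw [← hw] at e
  exact ((sq_eq_sq₀ (h3 x hx).le (h2 x hx).le).1 (mul_left_cancel₀ h1.ne' e)).symm

theorem intervalIntegrable_of_L2 (q : L2) : IntervalIntegrable q volume 0 1 := by
  rw [intervalIntegrable_iff_integrableOn_Ioo_of_le zero_le_one]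
  exact (Lp.memLp q).integrable (by norm_num)

end Uniqueness

end MixedSturmLiouville

open MixedSturmLiouville

theorem theorem2p3 (q p : MixedSturmLiouville.L2) (b h : ℝ)
    (heig : ∀ n : ℕ,
      MixedSturmLiouville.eigenvalue q b n = MixedSturmLiouville.eigenvalue p h n)
    (hnorm : ∀ n : ℕ,
      MixedSturmLiouville.normingConstant q b n = MixedSturmLiouville.normingConstant p h n) :
    (q, b) = (p, h) := by
  have hq := intervalIntegrable_of_L2 q
  have hp := intervalIntegrable_of_L2 p
  have hrange := range_eigenvalue hq b
  have hzero : ∀ r, charFun hq b r = 0 ↔ charFun hp h r = 0 := by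
    have : {r | charFun hq b r = 0} = {r | charFun hp h r = 0} := by
      rw [← hrange, ← range_eigenvalue hp h, funext heig]
    exact fun r => Set.ext_iff.1 this r
  have hval : ∀ r, charFun hq b r = 0 → |solution hq 0 1 r 1| = |solution hp 0 1 r 1| := by
    intro r hr
    obtain ⟨n, rfl⟩ : r ∈ range (eigenvalue q b) := hrange ▸ hr
    have hn := hnorm n
    -- `Real.log` is even, so the factor `(-1)^n` drops out and only absolute values are compared.
    rw [normingConstant, normingConstant, ← heig n, phi_one_eq_solution hq,
      phi_one_eq_solution hp, ← Real.log_abs, ← Real.log_abs ((-1) ^ n * solution hp 0 1 _ 1)] at hn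
    simp only [abs_mul, abs_neg_one_pow, one_mul] at hn
    exact Real.log_injOn_pos (abs_pos.2 (solution_one_ne_zero hq hr))
      (abs_pos.2 (solution_one_ne_zero hp ((hzero _).1 hr))) hn
  obtain ⟨hbh, hqp⟩ := eq_and_ae_eq_of_charFun hq hp hzero hval
  exact Prod.ext (Lp.ext (ae_unitMeasure_iff.2 hqp)) hbh
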